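/- **Setting.** Interest rates are zero. Let $\mathcal T\subseteq[0,T]$ be a set of times with $0\in\mathcal T$ that is mapped to itself by $t\mapsto \bar t:=T-t$; for instance a grid $\{T_0,\dots,T_N\}$, $T_j=j\,T/N$ (then $\overline{T_j}=T_{N-j}$), or all of $[0,T]$. Let $S=(S_t)_{t\in\mathcal T}$ be a Markov process (for a given filtration) with values in $(0,\infty)$ on a probability space with measure $\mathbb Q$, with a transition function $\kappa_{s,t}(x,dy)$ on $(0,\infty)$ (Markov kernels for $s\le t$ satisfying Chapman–Kolmogorov, with $\kappa_{t,t}(x,\cdot)=\delta_x$), and assume that $\kappa_{s,t}(x,\cdot)$ has a Lebesgue density for all $s<t$ and $x>0$. For $s<t$ and $K,x>0$ let $$P_{s,t}(K|x)=\int (K-y)^+\,\kappa_{s,t}(x,dy),\quad C_{s,t}(K|x)=\int (y-K)^+\,\kappa_{s,t}(x,dy),\quad \Gamma_{s,t}(K|x)=\partial_x^2P_{s,t}(K|x)$$ be the values of puts and calls given the spot value $x$, and the Gamma (which exists for almost every $x$ in the cases considered; set it to $0$ elsewhere). Consider the following properties. * *Martingale transitions*: $\int y\,\kappa_{s,t}(x,dy)=x$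 for all $s\le t$, $x>0$. * *(A2)*: $P_{s,t}(\alpha K|\alpha x)=\alpha P_{s,t}(K|x)$ for all $s<t$ and $\alpha,K,x>0$. * *Spot regularity*: for all $s<t$, $K>0$, the function $x\mapsto P_{s,t}(K|x)$ is convex and differentiable on $(0,\infty)$ with locally absolutely continuous derivative, $P_{s,t}(K|x)\to0$ as $x\to\infty$, and $C_{s,t}(K|x)/x\to0$ as $x\downarrow0$. * *Put–call symmetry*: $C_{s,t}(K|x)/\sqrt K=P_{s,t}(K'|x)/\sqrt{K'}$ for all $s<t$ and $x,K,K'>0$ with $KK'=x^2$. A process $\tilde S=(\tilde S_t)_{t\in\mathcal T}$ with values in $(0,\infty)$ on a probability space with measure $\tilde{\mathbb Q}$ is called *reverse $\Gamma$-adjoint* to $S$ if it is a Markov process (for some filtration) with a transition function $\tilde\kappa$ on $(0,\infty)$ such that, for all $t<t'$ in $\mathcal T$ and $k>0$, $\Gamma_{\bar t',\bar t}(k|\cdot)\ge 0$ almost everywhere and $$\tilde\kappa_{t,t'}(k,dk')=\Gamma_{\bar t',\bar t}(k\,|\,k')\,dk'.$$ **Statement.** If (A2) holds and the process $S$ is a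 $\mathbb Q$-martingale, then $S$ has martingale transitions. Moreover: (a) Suppose $S$ has martingale transitions, and (A2) or spot regularity holds. Then for all $t<t'$ in $\mathcal T$ and $k>0$ one has $\Gamma_{\bar t',\bar t}(k|k')\ge0$ for all $k'>0$ and $\int_0^\infty\Gamma_{\bar t',\bar t}(k|k')\,dk'=1$; for $t<t'<t''$ and $k>0$ the Chapman–Kolmogorov equation $$\Gamma_{\bar t'',\bar t}(k|k'')=\int_0^\infty\Gamma_{\bar t',\bar t}(k|k')\,\Gamma_{\bar t'',\bar t'}(k'|k'')\,dk'$$ holds for almost every $k''>0$; and there is a transition function $\tilde\kappa$ on $(0,\infty)$ with $\tilde\kappa_{t,t'}(k,dk')=\Gamma_{\bar t',\bar t}(k|k')\,dk'$ for all $t<t'$ and $k>0$. (b) Under the assumptions of (a), for every probability distribution $\nu$ on $(0,\infty)$ there is a process $\tilde S=(\tilde S_t)_{t\in\mathcal T}$, on some probability space, that is reverse $\Gamma$-adjoint to $S$ and satisfies $\tilde S_0\sim\nu$; in particular (with $\mathcal T=[0,T]$) in continuous time. Now let $\tilde S$ (on $\tilde{\mathbb Q}$), with transition function $\tilde\kappa$,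 be any reverse $\Gamma$-adjoint process to $S$ (on $\mathbb Q$). (c) Under the assumptions of (a), $\tilde S$ has martingale transitions, and if $\tilde S_0$ is integrable, then $\tilde S$ is a $\tilde{\mathbb Q}$-martingale. (d) If $S$ satisfies (A2), so does $\tilde S$ (with put values computed from $\tilde\kappa$), and for all $t<t'$ in $\mathcal T$ the log-returns $\ln(S_{\bar t}/S_{\bar t'})$ and $\ln(\tilde S_{t'}/\tilde S_t)$ have densities $q$ under $\mathbb Q$ and $\tilde q$ under $\tilde{\mathbb Q}$, with $\tilde q(\xi)=e^{-\xi}q(-\xi)$ for almost every $\xi\in\mathbb R$. (e) If $S$ satisfies (A2) and put–call symmetry, then $\tilde S_{t'}/\tilde S_t\stackrel{d}{=}S_{\bar t}/S_{\bar t'}$ for all $t<t'$ in $\mathcal T$. Furthermore, for all constants $\sigma,S_0>0$ and every Brownian motion $W$, the Black–Scholes process $S_t=S_0\exp(\sigma W_t-\tfrac12\sigma^2t)$, $t\in\mathcal T$, is its own reverse $\Gamma$-adjoint process: it is Markov for its natural filtration, with transition function $\kappa_{s,t}(x,\cdot)=$ law of $x\,e^{Z}$, $Z\sim N(-\tfrac12\sigma^2(t-s),\sigma^2(t-s))$,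 and $\kappa_{t,t'}(k,dk')=\Gamma_{\bar t',\bar t}(k|k')\,dk'$ for $t<t'$, $k>0$, with $\Gamma$ computed from $\kappa$ itself. -/

import Mathlib

open MeasureTheory ProbabilityTheory Filter
open scoped NNReal ENNReal Topology ProbabilityTheory

noncomputable section

/-- The state space `(0, ∞)` of positive asset prices, with its Lebesgue measure `volume`. -/
abbrev Pos : Type := ↥(Set.Ioi (0 : ℝ))

instance : MeasureSpace Pos := Measure.Subtype.measureSpace

/-- A set of trading times in `[0, T]` that contains `0` and is mapped to itself by the time
reversal `t ↦ T - t`, for instance an equidistant grid or the whole interval `[0, T]`. -/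
structure ReversibleTimes where
  horizon : ℝ
  times : Set ℝ
  zero_mem : (0 : ℝ) ∈ times
  subset_Icc : times ⊆ Set.Icc 0 horizon
  rev_mem : ∀ t ∈ times, horizon - t ∈ times

namespace ReversibleTimes

/-- Continuous time `[0, T]`. -/
def interval (T : ℝ) (hT : 0 ≤ T) : ReversibleTimes where
  horizon := T
  times := Set.Icc 0 T
  zero_mem := ⟨le_refl _, hT⟩
  subset_Icc := subset_rfl
  rev_mem := fun t ht => ⟨by linarith [ht.2], by linarith [ht.1]⟩

/-- The grid of times `T_j = j Δ`, `j = 0, …, N`. Its time reversal is `T_j ↦ T_{N-j}`. -/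
def grid (N : ℕ) (Δ : ℝ) (hΔ : 0 ≤ Δ) : ReversibleTimes where
  horizon := N * Δ
  times := {t | ∃ j : ℕ, j ≤ N ∧ t = j * Δ}
  zero_mem := ⟨0, Nat.zero_le _, by simp⟩
  subset_Icc := by
    rintro t ⟨j, hj, rfl⟩
    exact ⟨by positivity, mul_le_mul_of_nonneg_right (by exact_mod_cast hj) hΔ⟩
  rev_mem := by
    rintro t ⟨j, hj, rfl⟩
    exact ⟨N - j, Nat.sub_le _ _, by rw [Nat.cast_sub hj]; ring⟩

/-- The time reversal `t ↦ T - t`. -/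
def rev (𝒯 : ReversibleTimes) (t : 𝒯.times) : 𝒯.times :=
  ⟨𝒯.horizon - t, 𝒯.rev_mem t t.2⟩

/-- The initial time `0`. -/
def start (𝒯 : ReversibleTimes) : 𝒯.times := ⟨0, 𝒯.zero_mem⟩

end ReversibleTimes

/-- A (possibly time-inhomogeneous) Markov transition function on `(0, ∞)`: for `s ≤ t`,
`kernel s t x` is the law of the price at time `t` given the spot value `x` at time `s`. -/
structure TransitionFunction (I : Type*) [Preorder I] where
  kernel : I → I → Kernel Pos Pos
  markov : ∀ s t : I, s ≤ t → IsMarkovKernel (kernel s t)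
  refl : ∀ t : I, kernel t t = Kernel.id
  chapman_kolmogorov : ∀ s t u : I, s ≤ t → t ≤ u → kernel t u ∘ₖ kernel s t = kernel s u

namespace TransitionFunction

variable {I : Type*} [Preorder I]

/-- The value at time `s` of the put with strike `K` and maturity `t`, given the spot value `x > 0`
at time `s` (zero interest rates). -/
def put (κ : TransitionFunction I) (s t : I) (K x : ℝ) : ℝ :=
  if hx : 0 < x then ∫ y, max (K - (y : ℝ)) 0 ∂(κ.kernel s t ⟨x, hx⟩) else 0

/-- The value at time `s` of the call with strike `K` and maturity `t`, given the spot value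
`x > 0` at time `s` (zero interest rates). -/
def call (κ : TransitionFunction I) (s t : I) (K x : ℝ) : ℝ :=
  if hx : 0 < x then ∫ y, max ((y : ℝ) - K) 0 ∂(κ.kernel s t ⟨x, hx⟩) else 0

/-- The Gamma `Γ_{s,t}(K | x)`: the second derivative of the put value in the spot value. -/
def gamma (κ : TransitionFunction I) (s t : I) (K x : ℝ) : ℝ :=
  deriv (deriv (κ.put s t K)) x

/-- The price is continuously distributed: all transition laws have a Lebesgue density. -/
def ContinuouslyDistributed (κ : TransitionFunction I) : Prop :=
  ∀ s t : I, s < t → ∀ x : Pos, κ.kernel s t x ≪ (volume : Measure Pos)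

/-- Scaling property (A2): `P(α K | α x) = α P(K | x)`. -/
def ScalingProperty (κ : TransitionFunction I) : Prop :=
  ∀ s t : I, s < t → ∀ α K x : ℝ, 0 < α → 0 < K → 0 < x →
    κ.put s t (α * K) (α * x) = α * κ.put s t K x

/-- The price is a martingale, whatever the spot value it starts from. -/
def IsMartingale (κ : TransitionFunction I) : Prop :=
  ∀ s t : I, s ≤ t → ∀ x : Pos,
    Integrable (fun y : Pos => (y : ℝ)) (κ.kernel s t x) ∧ ∫ y, (y : ℝ) ∂(κ.kernel s t x) = x

/-- Put-call symmetry: `C(K | x) / √K = P(K' | x) / √K'` for all strikes with `K K' = x²`. -/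
def PutCallSymmetry (κ : TransitionFunction I) : Prop :=
  ∀ s t : I, s < t → ∀ x K K' : ℝ, 0 < x → 0 < K → 0 < K' → K * K' = x ^ 2 →
    κ.call s t K x / √K = κ.put s t K' x / √K'

/-- Regularity of vanilla options in the spot value: put values are convex in the spot, twice
differentiable in the spot (in the weak form that the Delta is locally absolutely continuous, so
that the Gamma exists almost everywhere and integrates to the Delta), puts become worthless as the
spot tends to infinity, and calls become worthless faster than the spot as the spot tends to `0`. -/
structure SpotRegular (κ : TransitionFunction I) : Prop where
  convex : ∀ s t : I, s < t → ∀ K : ℝ, 0 < K → ConvexOn ℝ (Set.Ioi 0) (κ.put s t K)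
  differentiable : ∀ s t : I, s < t → ∀ K : ℝ, 0 < K →
    DifferentiableOn ℝ (κ.put s t K) (Set.Ioi 0)
  delta_absolutelyContinuous : ∀ s t : I, s < t → ∀ K : ℝ, 0 < K → ∀ a b : ℝ, 0 < a → a ≤ b →
    AbsolutelyContinuousOnInterval (deriv (κ.put s t K)) a b
  put_tendsto : ∀ s t : I, s < t → ∀ K : ℝ, 0 < K → Tendsto (κ.put s t K) atTop (𝓝 0)
  call_tendsto : ∀ s t : I, s < t → ∀ K : ℝ, 0 < K →
    Tendsto (fun x => κ.call s t K x / x) (𝓝[>] 0) (𝓝 0)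

end TransitionFunction

/-- `X` is, under `Q`, a Markov process for the filtration `ℱ` with transition function `κ`:
`Q(X_t ∈ B | ℱ_s) = κ_{s,t}(X_s, B)` for `s ≤ t`. -/
structure IsMarkovProcess {I : Type*} [Preorder I] (κ : TransitionFunction I)
    {Ω : Type*} [mΩ : MeasurableSpace Ω] (X : I → Ω → Pos) (ℱ : Filtration I mΩ)
    (Q : Measure Ω) : Prop where
  adapted : ∀ t : I, Measurable[ℱ t] (X t)
  transition : ∀ s t : I, s ≤ t → ∀ B : Set Pos, MeasurableSet B →
    Q[(X t ⁻¹' B).indicator (fun _ => (1 : ℝ)) | ℱ s] =ᵐ[Q] fun ω => (κ.kernel s t (X s ω)).real B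

/-- The transition function `κ'` is reverse `Γ`-adjoint to `κ`: for `t < t'` and `k > 0`,
`κ'_{t,t'}(k, dk') = Γ_{T-t',T-t}(k | k') dk'`, where `Γ` comes from vanilla options priced
with `κ`. -/
def IsReverseGammaAdjointKernel {𝒯 : ReversibleTimes} (κ κ' : TransitionFunction 𝒯.times) : Prop :=
  ∀ t t' : 𝒯.times, t < t' → ∀ k : Pos,
    (∀ᵐ k' : Pos, 0 ≤ κ.gamma (𝒯.rev t') (𝒯.rev t) k k') ∧
    κ'.kernel t t' k = (volume : Measure Pos).withDensity
      (fun k' => ENNReal.ofReal (κ.gamma (𝒯.rev t') (𝒯.rev t) k k'))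

/-- The Black–Scholes transition law over a time step of length `d`, with volatility `σ` and zero
interest rate: the law of `x exp(Z)` with `Z ~ N(-σ² d / 2, σ² d)`. -/
def bsStep (σ d : ℝ) : Kernel Pos Pos :=
  (Kernel.id ×ₖ Kernel.const Pos (gaussianReal (-(σ ^ 2 * d / 2)) (σ ^ 2 * d).toNNReal)).map
    (fun p : Pos × ℝ => (⟨(p.1 : ℝ) * Real.exp p.2, mul_pos p.1.2 (Real.exp_pos _)⟩ : Pos))

theorem measurable_mulExp : Measurable
    (fun p : Pos × ℝ => (⟨(p.1 : ℝ) * Real.exp p.2, mul_pos p.1.2 (Real.exp_pos _)⟩ : Pos)) := by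
  apply Measurable.subtype_mk
  fun_prop

theorem bsStep_apply' (σ d : ℝ) (x : Pos) {B : Set Pos} (hB : MeasurableSet B) :
    bsStep σ d x B = gaussianReal (-(σ ^ 2 * d / 2)) (σ ^ 2 * d).toNNReal
      {z : ℝ | (⟨(x : ℝ) * Real.exp z, mul_pos x.2 (Real.exp_pos _)⟩ : Pos) ∈ B} := by
  unfold bsStep
  rw [Kernel.map_apply' _ measurable_mulExp _ hB, Kernel.id_prod_apply' _ _ (measurable_mulExp hB)]
  rfl

instance (σ d : ℝ) : IsMarkovKernel (bsStep σ d) := Kernel.IsMarkovKernel.map _ measurable_mulExp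

theorem bsStep_zero (σ : ℝ) : bsStep σ 0 = Kernel.id := by
  ext x B hB
  rw [bsStep_apply' σ 0 x hB, Kernel.id_apply]
  have hx : Measurable (fun z : ℝ =>
      (⟨(x : ℝ) * Real.exp z, mul_pos x.2 (Real.exp_pos _)⟩ : Pos)) :=
    measurable_mulExp.comp (measurable_const.prodMk measurable_id)
  have h0 : (⟨(x : ℝ) * Real.exp 0, mul_pos x.2 (Real.exp_pos _)⟩ : Pos) = x := by
    ext; simp
  have hg : gaussianReal (-(σ ^ 2 * 0 / 2)) (σ ^ 2 * 0).toNNReal = Measure.dirac 0 := by simp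
  have := Measure.map_dirac' hx (0 : ℝ)
  rw [h0] at this
  rw [hg, ← this, Measure.map_apply hx hB]
  rfl

theorem bsStep_comp (σ d e : ℝ) (hd : 0 ≤ d) (he : 0 ≤ e) :
    bsStep σ e ∘ₖ bsStep σ d = bsStep σ (d + e) := by
  ext x B hB
  have hx : Measurable (fun z : ℝ =>
      (⟨(x : ℝ) * Real.exp z, mul_pos x.2 (Real.exp_pos _)⟩ : Pos)) :=
    measurable_mulExp.comp (measurable_const.prodMk measurable_id)
  have hstep : bsStep σ d x = (gaussianReal (-(σ ^ 2 * d / 2)) (σ ^ 2 * d).toNNReal).map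
      (fun z : ℝ => (⟨(x : ℝ) * Real.exp z, mul_pos x.2 (Real.exp_pos _)⟩ : Pos)) := by
    ext C hC
    rw [bsStep_apply' σ d x hC, Measure.map_apply hx hC]
    rfl
  have hconv : gaussianReal (-(σ ^ 2 * (d + e) / 2)) (σ ^ 2 * (d + e)).toNNReal =
      (gaussianReal (-(σ ^ 2 * d / 2)) (σ ^ 2 * d).toNNReal) ∗
        (gaussianReal (-(σ ^ 2 * e / 2)) (σ ^ 2 * e).toNNReal) := by
    rw [gaussianReal_conv_gaussianReal, ← Real.toNNReal_add (by positivity) (by positivity)]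
    congr 1 <;> ring_nf
  have hm : MeasurableSet {z : ℝ |
      (⟨(x : ℝ) * Real.exp z, mul_pos x.2 (Real.exp_pos _)⟩ : Pos) ∈ B} := hx hB
  rw [Kernel.comp_apply' _ _ _ hB, bsStep_apply' σ _ x hB, hconv, hstep,
    lintegral_map (Kernel.measurable_coe _ hB) hx, Measure.conv,
    Measure.map_apply (by fun_prop) hm, Measure.prod_apply ((by fun_prop : Measurable
      (fun p : ℝ × ℝ => p.1 + p.2)) hm)]
  refine lintegral_congr fun z => ?_
  rw [bsStep_apply' σ e _ hB]
  congr 1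
  ext w
  simp [Real.exp_add, mul_assoc]

/-- The Black–Scholes transition function with constant volatility `σ`. -/
def bsTransition (𝒯 : ReversibleTimes) (σ : ℝ) : TransitionFunction 𝒯.times where
  kernel s t := bsStep σ ((t : ℝ) - s)
  markov _ _ _ := inferInstance
  refl t := by rw [sub_self, bsStep_zero]
  chapman_kolmogorov s t u hst htu := by
    rw [bsStep_comp σ _ _ (sub_nonneg.2 hst) (sub_nonneg.2 htu)]
    congr 1
    ring

/-- The Black–Scholes price process `S_t = S_0 exp(σ W_t - σ² t / 2)`, driven by `W`. -/
def bsProcess (𝒯 : ReversibleTimes) (σ : ℝ) (S₀ : Pos) {Ω : Type*} (W : ℝ≥0 → Ω → ℝ)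
    (t : 𝒯.times) (ω : Ω) : Pos :=
  ⟨(S₀ : ℝ) * Real.exp (σ * W ⟨t, (𝒯.subset_Icc t.2).1⟩ ω - σ ^ 2 * t / 2),
    mul_pos S₀.2 (Real.exp_pos _)⟩

theorem stronglyMeasurable_bsProcess (𝒯 : ReversibleTimes) (σ : ℝ) (S₀ : Pos) {Ω : Type*}
    [MeasurableSpace Ω] {W : ℝ≥0 → Ω → ℝ} (hW : ∀ t, Measurable (W t)) (t : 𝒯.times) :
    StronglyMeasurable (bsProcess 𝒯 σ S₀ W t) := by
  apply Measurable.stronglyMeasurable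
  unfold bsProcess
  apply Measurable.subtype_mk
  have := hW ⟨t, (𝒯.subset_Icc t.2).1⟩
  fun_prop

end

/-! The engine is a duality between strike and spot. Fix `s < t` and a strike `k`, and let `P` be
the put value as a function of the spot. Convexity and the boundary conditions give `P' → 0` at
infinity and `P' → -1` at `0`, so `P''` is a probability density. Integrating `(K - x)⁺ P''(x)` by
parts gives `P(K) - k + K`, which by put-call parity is the call value with strike `k` and spot `K`.
So a put with strike `K` under the law `Γ(k | x) dx` has the value of a call with strike `k` under
the original law started at `K` (`IsMartingale.lintegral_gammaDensity_mul`): the two families of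
laws are dual with respect to the function `(y - k)⁺`.

Put prices determine a law on `(0, ∞)` (`measure_pos_ext_of_put`), so Chapman–Kolmogorov for the
Gammas may be tested on puts. There, duality and Tonelli turn it into Chapman–Kolmogorov for `κ`
with the order of the steps reversed, which is why time is reflected
(`IsMartingale.gammaKernel_comp`). The mean of `Γ(k | x) dx` is `k` because `min x n = n - (n - x)⁺`
and `P(n) → 0`. Convexity in the spot also yields joint measurability of the Gamma, so the laws form
genuine kernels. A process with these transitions then comes from consistent finite-dimensional laws
and the Kolmogorov extension theorem.

Under (A2) everything is explicit. The put prices force the return to have a law `μ` independent of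
the spot, so `P(x) = ∫ (k - x y)⁺ μ(dy)` and `P'(x) = -∫ y 1{x y < k} μ(dy)`. Increments of `P'` are
therefore masses of the image of `y μ(dy)` under `y ↦ k / y`, called `dualLaw`
(`withDensity_deriv_deriv_scaledPut`). This gives spot regularity when `μ` has mean one, and in any
case the scaling property of the adjoint and the density `e^{-ξ} q(-ξ)` of its log-returns. Put-call
symmetry says exactly that `μ` and its dual have the same put prices, hence coincide. For
Black–Scholes, self-duality is a reflection identity of the Gaussian density with mean `-v / 2` and
variance `v`. -/

/-! ### Put values as convex functions of the spot -/

/-- A function of the spot that behaves like the value of a put with strike `k`: convex, with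
locally absolutely continuous derivative, and with the boundary behaviour that put-call parity
imposes at `0` and at infinity. -/
structure IsPutCurve (k : ℝ) (P : ℝ → ℝ) : Prop where
  convex : ConvexOn ℝ (Set.Ioi 0) P
  differentiable : DifferentiableOn ℝ P (Set.Ioi 0)
  absolutelyContinuous : ∀ a b : ℝ, 0 < a → a ≤ b → AbsolutelyContinuousOnInterval (deriv P) a b
  tendsto_atTop : Tendsto P atTop (𝓝 0)
  tendsto_zero : Tendsto (fun x => (P x - k + x) / x) (𝓝[>] 0) (𝓝 0)

/-- The first derivative is monotone. The sign holds at every point and not just almost everywhere,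
because `deriv` is `0` where the second derivative does not exist. -/
theorem ConvexOn.deriv_deriv_nonneg {P : ℝ → ℝ} (hc : ConvexOn ℝ (Set.Ioi 0) P)
    (hd : DifferentiableOn ℝ P (Set.Ioi 0)) {x : ℝ} (hx : 0 < x) : 0 ≤ deriv (deriv P) x := by
  have hm : MonotoneOn (deriv P) (Set.Ioi 0) :=
    hc.monotoneOn_deriv fun y hy => (hd y hy).differentiableAt (Ioi_mem_nhds hy)
  rw [← derivWithin_of_isOpen isOpen_Ioi (Set.mem_Ioi.2 hx)]
  exact hm.derivWithin_nonneg

theorem tendsto_setLIntegral_Ioc (f : ℝ → ℝ≥0∞) (b : ℝ) :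
    Tendsto (fun n : ℕ => ∫⁻ x in Set.Ioc (1 / ((n : ℝ) + 1)) b, f x) atTop
      (𝓝 (∫⁻ x in Set.Ioc 0 b, f x)) := by
  have h : Set.Ioc 0 b = ⋃ n : ℕ, Set.Ioc (1 / ((n : ℝ) + 1)) b := by
    ext x
    simp only [Set.mem_Ioc, Set.mem_iUnion]
    constructor
    · rintro ⟨h0, h1⟩
      obtain ⟨n, hn⟩ := exists_nat_one_div_lt h0
      exact ⟨n, hn, h1⟩
    · rintro ⟨n, h0, h1⟩
      exact ⟨lt_trans (by positivity) h0, h1⟩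
  simp_rw [← withDensity_apply f measurableSet_Ioc]
  rw [h]
  refine tendsto_measure_iUnion_atTop fun m n hmn => Set.Ioc_subset_Ioc_left ?_
  exact one_div_le_one_div_of_le (by positivity) (by exact_mod_cast Nat.succ_le_succ hmn)

theorem tendsto_setLIntegral_Ioi (f : ℝ → ℝ≥0∞) :
    Tendsto (fun n : ℕ => ∫⁻ x in Set.Ioc (1 / ((n : ℝ) + 1)) (n + 1), f x) atTop
      (𝓝 (∫⁻ x in Set.Ioi 0, f x)) := by
  have h : Set.Ioi (0 : ℝ) = ⋃ n : ℕ, Set.Ioc (1 / ((n : ℝ) + 1)) (n + 1) := by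
    ext x
    simp only [Set.mem_Ioc, Set.mem_iUnion, Set.mem_Ioi]
    constructor
    · intro h0
      obtain ⟨n, hn⟩ := exists_nat_one_div_lt h0
      obtain ⟨m, hm⟩ := exists_nat_ge x
      refine ⟨max n m, lt_of_le_of_lt (one_div_le_one_div_of_le (by positivity) ?_) hn, ?_⟩
      · exact_mod_cast Nat.succ_le_succ (le_max_left n m)
      · have : (m : ℝ) ≤ (max n m : ℕ) := by exact_mod_cast le_max_right n m
        linarith
    · rintro ⟨n, h0, -⟩
      exact lt_trans (by positivity) h0
  simp_rw [← withDensity_apply f measurableSet_Ioc]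
  rw [h, ← withDensity_apply f (MeasurableSet.iUnion fun _ => measurableSet_Ioc)]
  refine tendsto_measure_iUnion_atTop fun m n hmn => Set.Ioc_subset_Ioc ?_ ?_
  · exact one_div_le_one_div_of_le (by positivity) (by exact_mod_cast Nat.succ_le_succ hmn)
  · exact_mod_cast Nat.succ_le_succ hmn

theorem tendsto_one_div_add_atTop_nhdsGT_zero :
    Tendsto (fun n : ℕ => 1 / ((n : ℝ) + 1)) atTop (𝓝[>] 0) :=
  tendsto_nhdsWithin_iff.2 ⟨tendsto_one_div_add_atTop_nhds_zero_nat,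
    Eventually.of_forall fun n => Set.mem_Ioi.2 (by positivity)⟩

/-- The mass that the second derivative of a convex function gives to a half-open interval. -/
theorem setLIntegral_deriv_deriv_Ioc {P : ℝ → ℝ} (hc : ConvexOn ℝ (Set.Ioi 0) P)
    (hd : DifferentiableOn ℝ P (Set.Ioi 0)) {a b : ℝ} (ha : 0 < a) (hab : a ≤ b)
    (hac : AbsolutelyContinuousOnInterval (deriv P) a b) :
    ∫⁻ x in Set.Ioc a b, ENNReal.ofReal (deriv (deriv P) x)
      = ENNReal.ofReal (deriv P b - deriv P a) := by
  have hi : IntegrableOn (deriv (deriv P)) (Set.Ioc a b) := by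
    have := hac.intervalIntegrable_deriv
    rwa [intervalIntegrable_iff_integrableOn_Ioc_of_le hab] at this
  rw [← hac.integral_deriv_eq_sub, intervalIntegral.integral_of_le hab,
    ofReal_integral_eq_lintegral_ofReal hi]
  filter_upwards [ae_restrict_mem measurableSet_Ioc] with x hx
  exact hc.deriv_deriv_nonneg hd (ha.trans hx.1)

namespace IsPutCurve

variable {k : ℝ} {P : ℝ → ℝ}

theorem differentiableAt (h : IsPutCurve k P) {x : ℝ} (hx : 0 < x) : DifferentiableAt ℝ P x :=
  (h.differentiable x hx).differentiableAt (Ioi_mem_nhds hx)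

/-- Convexity traps `P'(x)` between the difference quotients over `[x - 1, x]` and `[x, x + 1]`,
which vanish in the limit together with `P`. -/
theorem tendsto_deriv_atTop (h : IsPutCurve k P) : Tendsto (deriv P) atTop (𝓝 0) := by
  have h1 : Tendsto (fun x => P (x + 1) - P x) atTop (𝓝 0) := by
    simpa using (h.tendsto_atTop.comp (tendsto_atTop_add_const_right atTop 1 tendsto_id)).sub
      h.tendsto_atTop
  have h2 : Tendsto (fun x => P x - P (x - 1)) atTop (𝓝 0) := by
    simpa [sub_eq_add_neg] using h.tendsto_atTop.sub
      (h.tendsto_atTop.comp (tendsto_atTop_add_const_right atTop (-1) tendsto_id))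
  refine tendsto_of_tendsto_of_tendsto_of_le_of_le' h2 h1 ?_ ?_
  · filter_upwards [eventually_gt_atTop 1] with x hx
    have := h.convex.slope_le_deriv (x := x - 1) (y := x) (Set.mem_Ioi.2 (by linarith))
      (Set.mem_Ioi.2 (by linarith)) (by linarith) (h.differentiableAt (by linarith))
    simpa [slope_def_field] using this
  · filter_upwards [eventually_gt_atTop 0] with x hx
    have := h.convex.deriv_le_slope (x := x) (y := x + 1) (Set.mem_Ioi.2 (by linarith))
      (Set.mem_Ioi.2 (by linarith)) (by linarith) (h.differentiableAt (by linarith))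
    simpa [slope_def_field] using this

theorem tendsto_nhdsGT (h : IsPutCurve k P) : Tendsto P (𝓝[>] 0) (𝓝 k) := by
  have hx : Tendsto (fun x : ℝ => x) (𝓝[>] 0) (𝓝 0) := tendsto_nhdsWithin_of_tendsto_nhds tendsto_id
  have := ((h.tendsto_zero.mul hx).add_const k).sub hx
  simp only [mul_zero, zero_add, sub_zero] at this
  refine this.congr' ?_
  filter_upwards [self_mem_nhdsWithin] with x hx
  have : x ≠ 0 := ne_of_gt hx
  field_simp
  ring

/-- Write `P x = k - x + x e(x)` with `e → 0`. The error `x e(x)` is small only relative to `x`, so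
the trapping slopes are taken over the proportional intervals `[x / 2, x]` and `[x, 2 x]`, where
they equal `-1` plus combinations of values of `e`. -/
theorem tendsto_deriv_nhdsGT (h : IsPutCurve k P) : Tendsto (deriv P) (𝓝[>] 0) (𝓝 (-1)) := by
  set e : ℝ → ℝ := fun x => (P x - k + x) / x with he
  have hscale : ∀ c : ℝ, 0 < c → Tendsto (fun x => e (c * x)) (𝓝[>] 0) (𝓝 0) := by
    intro c hc
    refine h.tendsto_zero.comp (tendsto_nhdsWithin_iff.2 ⟨?_, ?_⟩)
    · have : Tendsto (fun x : ℝ => c * x) (𝓝 0) (𝓝 (c * 0)) := tendsto_id.const_mul c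
      rw [mul_zero] at this
      exact tendsto_nhdsWithin_of_tendsto_nhds this
    · filter_upwards [self_mem_nhdsWithin] with x hx
      exact mul_pos hc hx
  have hP : ∀ x, 0 < x → P x = k - x + x * e x := by
    intro x hx
    simp only [he]
    field_simp
    ring
  have h1 : Tendsto (fun x => -1 + 2 * e (2 * x) - e x) (𝓝[>] 0) (𝓝 (-1)) := by
    simpa using (((hscale 2 two_pos).const_mul 2).const_add (-1)).sub h.tendsto_zero
  have h2 : Tendsto (fun x => -1 + 2 * e x - e (2⁻¹ * x)) (𝓝[>] 0) (𝓝 (-1)) := by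
    simpa using ((h.tendsto_zero.const_mul 2).const_add (-1)).sub (hscale 2⁻¹ (by norm_num))
  refine tendsto_of_tendsto_of_tendsto_of_le_of_le' h2 h1 ?_ ?_
  · filter_upwards [self_mem_nhdsWithin] with x hx
    have hx : 0 < x := hx
    have := h.convex.slope_le_deriv (x := 2⁻¹ * x) (y := x) (Set.mem_Ioi.2 (by linarith))
      (Set.mem_Ioi.2 (by linarith)) (by linarith) (h.differentiableAt (by linarith))
    refine le_trans (le_of_eq ?_) this
    rw [slope_def_field, hP x hx, hP (2⁻¹ * x) (by positivity)]
    field_simp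
    ring
  · filter_upwards [self_mem_nhdsWithin] with x hx
    have hx : 0 < x := hx
    have := h.convex.deriv_le_slope (x := x) (y := 2 * x) (Set.mem_Ioi.2 (by linarith))
      (Set.mem_Ioi.2 (by linarith)) (by linarith) (h.differentiableAt (by linarith))
    refine le_trans this (le_of_eq ?_)
    rw [slope_def_field, hP x hx, hP (2 * x) (by positivity)]
    field_simp
    ring

/-- The mass is the total increase of the Delta, from `-1` at `0` to `0` at infinity. -/
theorem lintegral_deriv_deriv (h : IsPutCurve k P) :
    ∫⁻ x in Set.Ioi 0, ENNReal.ofReal (deriv (deriv P) x) = 1 := by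
  refine tendsto_nhds_unique (tendsto_setLIntegral_Ioi _) ?_
  have h1 : Tendsto (fun n : ℕ => ENNReal.ofReal (deriv P (n + 1) - deriv P (1 / ((n : ℝ) + 1))))
      atTop (𝓝 (ENNReal.ofReal (0 - (-1)))) := by
    refine ENNReal.tendsto_ofReal (Tendsto.sub ?_ ?_)
    · exact h.tendsto_deriv_atTop.comp
        (tendsto_atTop_add_const_right atTop 1 tendsto_natCast_atTop_atTop)
    · exact h.tendsto_deriv_nhdsGT.comp tendsto_one_div_add_atTop_nhdsGT_zero
  simp only [sub_neg_eq_add, zero_add, ENNReal.ofReal_one] at h1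
  refine h1.congr fun n => ?_
  have hn : 1 / ((n : ℝ) + 1) ≤ n + 1 := by
    have : (0 : ℝ) ≤ n := Nat.cast_nonneg n
    rw [div_le_iff₀ (by positivity)]
    nlinarith
  exact (setLIntegral_deriv_deriv_Ioc h.convex h.differentiable (by positivity) hn
    (h.absolutelyContinuous _ _ (by positivity) hn)).symm

/-- Integration by parts against `K - x`, whose boundary term at `K` vanishes; local absolute
continuity of the Delta is what licenses it. -/
theorem setLIntegral_deriv_deriv_mul_Ioc (h : IsPutCurve k P) {a K : ℝ} (ha : 0 < a)
    (haK : a ≤ K) :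
    ∫⁻ x in Set.Ioc a K, ENNReal.ofReal (deriv (deriv P) x) * ENNReal.ofReal (K - x)
      = ENNReal.ofReal (P K - P a - (K - a) * deriv P a) := by
  have hac := h.absolutelyContinuous a K ha haK
  have hlin : AbsolutelyContinuousOnInterval (fun x => K - x) a K :=
    (contDiff_const.sub contDiff_id).contDiffOn.absolutelyContinuousOnInterval
  have hsub : ∀ x ∈ Set.uIcc a K, 0 < x := fun x hx => by
    rw [Set.uIcc_of_le haK] at hx
    exact ha.trans_le hx.1
  have hftc : ∫ x in a..K, deriv P x = P K - P a :=
    intervalIntegral.integral_deriv_eq_sub (fun x hx => h.differentiableAt (hsub x hx))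
      (hac.continuousOn.intervalIntegrable)
  have hparts := hlin.integral_mul_deriv_eq_deriv_mul hac
  have hd : ∀ x : ℝ, deriv (fun x => K - x) x = -1 := fun x => by simp
  simp only [hd, neg_mul, one_mul, intervalIntegral.integral_neg, hftc, sub_self, zero_mul,
    sub_neg_eq_add, zero_sub] at hparts
  have hi : IntegrableOn (fun x => (K - x) * deriv (deriv P) x) (Set.Ioc a K) := by
    have := hac.intervalIntegrable_deriv.continuousOn_mul hlin.continuousOn
    rwa [intervalIntegrable_iff_integrableOn_Ioc_of_le haK] at this
  rw [show P K - P a - (K - a) * deriv P a = -((K - a) * deriv P a) + (P K - P a) by ring,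
    ← hparts, intervalIntegral.integral_of_le haK, ofReal_integral_eq_lintegral_ofReal hi]
  · refine setLIntegral_congr_fun measurableSet_Ioc fun x hx => ?_
    have := h.convex.deriv_deriv_nonneg h.differentiable (ha.trans hx.1)
    rw [← ENNReal.ofReal_mul this, mul_comm]
  · filter_upwards [ae_restrict_mem measurableSet_Ioc] with x hx
    exact mul_nonneg (sub_nonneg.2 hx.2)
      (h.convex.deriv_deriv_nonneg h.differentiable (ha.trans hx.1))

/-- Puts under the law with density `P''` are worth as much as calls are worth on the curve. -/
theorem lintegral_deriv_deriv_mul (h : IsPutCurve k P) {K : ℝ} (hK : 0 < K) :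
    ∫⁻ x in Set.Ioi 0, ENNReal.ofReal (deriv (deriv P) x) * ENNReal.ofReal (K - x)
      = ENNReal.ofReal (P K - k + K) := by
  have hsplit : ∫⁻ x in Set.Ioi 0, ENNReal.ofReal (deriv (deriv P) x) * ENNReal.ofReal (K - x)
      = ∫⁻ x in Set.Ioc 0 K, ENNReal.ofReal (deriv (deriv P) x) * ENNReal.ofReal (K - x) := by
    rw [← Set.Ioc_union_Ioi_eq_Ioi hK.le, lintegral_union measurableSet_Ioi
      (Set.Ioc_disjoint_Ioi le_rfl), setLIntegral_congr_fun (g := fun _ => 0) measurableSet_Ioi,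
      lintegral_zero, add_zero]
    intro x hx
    simp only [ENNReal.ofReal_of_nonpos (sub_nonpos.2 (le_of_lt (Set.mem_Ioi.1 hx))), mul_zero]
  rw [hsplit]
  refine tendsto_nhds_unique (tendsto_setLIntegral_Ioc _ K) ?_
  have hid : Tendsto (fun x : ℝ => x) (𝓝[>] 0) (𝓝 0) :=
    tendsto_nhdsWithin_of_tendsto_nhds tendsto_id
  have h1 : Tendsto (fun a => ENNReal.ofReal (P K - P a - (K - a) * deriv P a)) (𝓝[>] 0)
      (𝓝 (ENNReal.ofReal (P K - k - (K - 0) * (-1)))) :=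
    ENNReal.tendsto_ofReal ((tendsto_const_nhds.sub h.tendsto_nhdsGT).sub
      ((tendsto_const_nhds.sub hid).mul h.tendsto_deriv_nhdsGT))
  rw [show P K - k - (K - 0) * (-1) = P K - k + K by ring] at h1
  refine (h1.comp tendsto_one_div_add_atTop_nhdsGT_zero).congr' ?_
  filter_upwards [(tendsto_one_div_add_atTop_nhds_zero_nat (𝕜 := ℝ)).eventually_lt_const hK]
    with n hn
  exact (h.setLIntegral_deriv_deriv_mul_Ioc (by positivity) hn.le).symm

end IsPutCurve

/-! ### Laws on the positive half-line and their put prices -/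

theorem lintegral_pos (f : ℝ → ℝ≥0∞) : ∫⁻ y : Pos, f y = ∫⁻ x in Set.Ioi 0, f x :=
  lintegral_subtype_comap measurableSet_Ioi f

theorem map_val_volume_pos :
    (volume : Measure Pos).map Subtype.val = (volume : Measure ℝ).restrict (Set.Ioi 0) :=
  map_comap_subtype_coe measurableSet_Ioi _

instance sigmaFinite_volume_pos : SigmaFinite (volume : Measure Pos) := by
  have : SigmaFinite ((volume : Measure Pos).map Subtype.val) := by
    rw [map_val_volume_pos]
    infer_instance
  exact SigmaFinite.of_map _ measurable_subtype_coe.aemeasurable this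

theorem integrable_put_payoff (μ : Measure Pos) [IsFiniteMeasure μ] (K : ℝ) :
    Integrable (fun y : Pos => max (K - (y : ℝ)) 0) μ := by
  refine Integrable.of_bound (by fun_prop) |K| (Eventually.of_forall fun y => ?_)
  have hy : (0 : ℝ) < y := y.2
  rw [Real.norm_of_nonneg (le_max_right _ _)]
  exact max_le (by linarith [le_abs_self K]) (abs_nonneg K)

theorem ofReal_integral_put_payoff (μ : Measure Pos) [IsFiniteMeasure μ] (K : ℝ) :
    ENNReal.ofReal (∫ y, max (K - (y : ℝ)) 0 ∂μ) = ∫⁻ y, ENNReal.ofReal (K - (y : ℝ)) ∂μ := by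
  rw [ofReal_integral_eq_lintegral_ofReal (integrable_put_payoff μ K)
    (Eventually.of_forall fun y => le_max_right _ _)]
  refine lintegral_congr fun y => ?_
  rw [ENNReal.ofReal_max, ENNReal.ofReal_zero, max_eq_left zero_le]

/-- A law on `(0, ∞)` is determined by the put prices (the formula of Breeden and Litzenberger). -/
theorem measure_pos_ext_of_put {μ ν : Measure Pos} [IsFiniteMeasure μ] [IsFiniteMeasure ν]
    (h : ∀ K : ℝ, 0 < K →
      ∫⁻ y, ENNReal.ofReal (K - (y : ℝ)) ∂μ = ∫⁻ y, ENNReal.ofReal (K - (y : ℝ)) ∂ν) : μ = ν := by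
  -- Right difference quotients of the put payoff in the strike are bounded by `1` and converge
  -- pointwise to the indicator of `y ≤ a`. Quotients from the right produce the closed half-line.
  have key : ∀ (ρ : Measure Pos) [IsFiniteMeasure ρ] (a : Pos),
      Tendsto (fun n : ℕ => ((n : ℝ) + 1) * (∫ y, max ((a : ℝ) + 1 / ((n : ℝ) + 1) - (y : ℝ)) 0 ∂ρ -
        ∫ y, max ((a : ℝ) - (y : ℝ)) 0 ∂ρ)) atTop (𝓝 (ρ.real (Set.Iic a))) := by
    intro ρ _ a
    have h0 : ρ.real (Set.Iic a) = ∫ y, (Set.Iic a).indicator (fun _ => (1 : ℝ)) y ∂ρ := by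
      rw [integral_indicator measurableSet_Iic]
      simp
    have h1 : ∀ n : ℕ, ((n : ℝ) + 1) * (∫ y, max ((a : ℝ) + 1 / ((n : ℝ) + 1) - (y : ℝ)) 0 ∂ρ -
        ∫ y, max ((a : ℝ) - (y : ℝ)) 0 ∂ρ) = ∫ y : Pos, ((n : ℝ) + 1) *
          (max ((a : ℝ) + 1 / ((n : ℝ) + 1) - (y : ℝ)) 0 - max ((a : ℝ) - (y : ℝ)) 0) ∂ρ := by
      intro n
      rw [integral_const_mul, integral_sub (integrable_put_payoff ρ _) (integrable_put_payoff ρ _)]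
    simp_rw [h1, h0]
    refine tendsto_integral_of_dominated_convergence (fun _ => (1 : ℝ)) (fun n => by fun_prop)
      (integrable_const _) (fun n => Eventually.of_forall fun y => ?_)
      (Eventually.of_forall fun y => ?_)
    · have hn : (0 : ℝ) < (n : ℝ) + 1 := by positivity
      have hlip : |max ((a : ℝ) + 1 / ((n : ℝ) + 1) - (y : ℝ)) 0 - max ((a : ℝ) - (y : ℝ)) 0|
          ≤ 1 / ((n : ℝ) + 1) := by
        refine (abs_max_sub_max_le_abs _ _ _).trans (le_of_eq ?_)
        rw [show (a : ℝ) + 1 / ((n : ℝ) + 1) - (y : ℝ) - ((a : ℝ) - y) = 1 / ((n : ℝ) + 1) by ring,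
          abs_of_pos (by positivity)]
      rw [Real.norm_eq_abs, abs_mul, abs_of_pos hn]
      calc _ ≤ ((n : ℝ) + 1) * (1 / ((n : ℝ) + 1)) := by gcongr
        _ = 1 := by field_simp
    · refine tendsto_const_nhds.congr' ?_
      by_cases hy : y ≤ a
      · refine Eventually.of_forall fun n => ?_
        have hya : (y : ℝ) ≤ a := hy
        have hn : (0 : ℝ) < 1 / ((n : ℝ) + 1) := by positivity
        have h1 : (0 : ℝ) ≤ a - y := by linarith
        have h2 : 0 ≤ (a : ℝ) + 1 / ((n : ℝ) + 1) - y := by linarith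
        simp only [Set.indicator_of_mem (Set.mem_Iic.2 hy), max_eq_left h1, max_eq_left h2]
        field_simp
        ring
      · have hya : (a : ℝ) < y := not_le.1 hy
        filter_upwards [(tendsto_one_div_add_atTop_nhds_zero_nat (𝕜 := ℝ)).eventually_lt_const
          (sub_pos.2 hya)] with n hn
        have h1 : (a : ℝ) - y ≤ 0 := by linarith
        have h2 : (a : ℝ) + 1 / ((n : ℝ) + 1) - y ≤ 0 := by linarith
        simp only [Set.indicator_of_notMem (show y ∉ Set.Iic a from hy), max_eq_right h1,
          max_eq_right h2, sub_zero, mul_zero]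
  have hreal : ∀ K : ℝ, 0 < K →
      ∫ y, max (K - (y : ℝ)) 0 ∂μ = ∫ y, max (K - (y : ℝ)) 0 ∂ν := by
    intro K hK
    have := h K hK
    rw [← ofReal_integral_put_payoff, ← ofReal_integral_put_payoff] at this
    exact (ENNReal.ofReal_eq_ofReal_iff (integral_nonneg fun _ => le_max_right _ _)
      (integral_nonneg fun _ => le_max_right _ _)).1 this
  refine Measure.ext_of_Iic _ _ fun a => ?_
  have hμν : μ.real (Set.Iic a) = ν.real (Set.Iic a) := by
    refine tendsto_nhds_unique (key μ a) ((key ν a).congr fun n => ?_)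
    have ha : (0 : ℝ) < a := a.2
    rw [hreal _ ha, hreal _ (by positivity)]
  rwa [measureReal_def, measureReal_def, ENNReal.toReal_eq_toReal_iff' (measure_ne_top _ _)
    (measure_ne_top _ _)] at hμν

/-! ### Put-call parity and the duality of strike and spot -/

namespace TransitionFunction

variable {I : Type*} [Preorder I] (κ : TransitionFunction I)

theorem put_coe (s t : I) (K : ℝ) (x : Pos) :
    κ.put s t K x = ∫ y, max (K - (y : ℝ)) 0 ∂(κ.kernel s t x) := dif_pos x.2

theorem call_coe (s t : I) (K : ℝ) (x : Pos) :
    κ.call s t K x = ∫ y, max ((y : ℝ) - K) 0 ∂(κ.kernel s t x) := dif_pos x.2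

theorem put_nonneg (s t : I) (K x : ℝ) : 0 ≤ κ.put s t K x := by
  unfold put
  split_ifs
  · exact integral_nonneg fun _ => le_max_right _ _
  · exact le_rfl

variable {κ} {s t : I}

theorem ofReal_put (hst : s ≤ t) (K : ℝ) (x : Pos) :
    ENNReal.ofReal (κ.put s t K x) = ∫⁻ y, ENNReal.ofReal (K - (y : ℝ)) ∂(κ.kernel s t x) := by
  have := κ.markov s t hst
  rw [put_coe, ofReal_integral_put_payoff]

/-- Put-call parity. -/
theorem IsMartingale.call_eq (hκ : κ.IsMartingale) (hst : s ≤ t) (K : ℝ) (x : Pos) :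
    κ.call s t K x = κ.put s t K x - K + x := by
  have := κ.markov s t hst
  obtain ⟨hi, hx⟩ := hκ s t hst x
  rw [call_coe, put_coe]
  have h : ∀ y : Pos, max ((y : ℝ) - K) 0 = max (K - (y : ℝ)) 0 - K + y := by
    intro y
    rcases le_total (y : ℝ) K with h | h
    · rw [max_eq_right (by linarith), max_eq_left (by linarith)]
      ring
    · rw [max_eq_left (by linarith), max_eq_right (by linarith)]
      ring
  simp_rw [h]
  have hs : Integrable (fun y : Pos => max (K - (y : ℝ)) 0 - K) (κ.kernel s t x) :=
    (integrable_put_payoff _ K).sub (integrable_const K)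
  rw [integral_add hs hi, integral_sub (integrable_put_payoff _ K) (integrable_const K), hx]
  simp

theorem IsMartingale.ofReal_call (hκ : κ.IsMartingale) (hst : s ≤ t) (K : ℝ) (x : Pos) :
    ENNReal.ofReal (κ.put s t K x - K + x)
      = ∫⁻ y, ENNReal.ofReal ((y : ℝ) - K) ∂(κ.kernel s t x) := by
  have := κ.markov s t hst
  have hi : Integrable (fun y : Pos => max ((y : ℝ) - K) 0) (κ.kernel s t x) :=
    ((hκ s t hst x).1.sub (integrable_const K)).pos_part
  rw [← hκ.call_eq hst, call_coe, ofReal_integral_eq_lintegral_ofReal hi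
    (Eventually.of_forall fun y => le_max_right _ _)]
  refine lintegral_congr fun y => ?_
  rw [ENNReal.ofReal_max, ENNReal.ofReal_zero, max_eq_left zero_le]

theorem IsMartingale.isPutCurve (hκ : κ.IsMartingale) (hr : κ.SpotRegular) (hst : s < t) {K : ℝ}
    (hK : 0 < K) : IsPutCurve K (κ.put s t K) where
  convex := hr.convex s t hst K hK
  differentiable := hr.differentiable s t hst K hK
  absolutelyContinuous := hr.delta_absolutelyContinuous s t hst K hK
  tendsto_atTop := hr.put_tendsto s t hst K hK
  tendsto_zero := by
    refine (hr.call_tendsto s t hst K hK).congr' ?_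
    filter_upwards [self_mem_nhdsWithin] with x hx
    rw [hκ.call_eq hst.le K ⟨x, hx⟩]

/-- The payoff is 1-Lipschitz in the strike. Together with continuity in the spot this makes put
values jointly continuous, the starting point for measurability of the Gamma. -/
theorem lipschitzWith_put (hst : s ≤ t) (x : ℝ) : LipschitzWith 1 fun K => κ.put s t K x := by
  by_cases hx : 0 < x
  · have := κ.markov s t hst
    refine LipschitzWith.of_dist_le_mul fun K K' => ?_
    rw [NNReal.coe_one, one_mul, κ.put_coe s t K ⟨x, hx⟩, κ.put_coe s t K' ⟨x, hx⟩,
      Real.dist_eq, ← integral_sub (integrable_put_payoff _ _) (integrable_put_payoff _ _)]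
    have hle := norm_integral_le_of_norm_le_const (μ := κ.kernel s t ⟨x, hx⟩)
      (f := fun y : Pos => max (K - (y : ℝ)) 0 - max (K' - (y : ℝ)) 0) (C := dist K K')
      (Eventually.of_forall fun y => ?_)
    · rwa [probReal_univ, mul_one, Real.norm_eq_abs] at hle
    rw [Real.norm_eq_abs, Real.dist_eq]
    refine (abs_max_sub_max_le_abs _ _ _).trans (le_of_eq ?_)
    congr 1
    ring
  · simp only [put, dif_neg hx]
    exact LipschitzWith.const' 0

/-- The density `k' ↦ Γ_{s,t}(k | k')` of the reverse `Γ`-adjoint transition law. -/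
noncomputable def gammaDensity (κ : TransitionFunction I) (s t : I) (k k' : Pos) : ℝ≥0∞ :=
  ENNReal.ofReal (κ.gamma s t k k')

theorem IsMartingale.lintegral_gammaDensity (hκ : κ.IsMartingale) (hr : κ.SpotRegular)
    (hst : s < t) (k : Pos) : ∫⁻ k', κ.gammaDensity s t k k' = 1 := by
  refine (lintegral_pos fun x => ENNReal.ofReal (κ.gamma s t k x)).trans ?_
  exact (hκ.isPutCurve hr hst k.2).lintegral_deriv_deriv

/-- Puts under the reverse `Γ`-adjoint law are calls under the original law, with strike and spot
interchanged. -/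
theorem IsMartingale.lintegral_gammaDensity_mul (hκ : κ.IsMartingale) (hr : κ.SpotRegular)
    (hst : s < t) (k K : Pos) :
    ∫⁻ k', κ.gammaDensity s t k k' * ENNReal.ofReal ((K : ℝ) - k')
      = ∫⁻ y, ENNReal.ofReal ((y : ℝ) - k) ∂(κ.kernel s t K) := by
  refine (lintegral_pos fun x => ENNReal.ofReal (κ.gamma s t k x) *
    ENNReal.ofReal ((K : ℝ) - x)).trans ?_
  rw [← hκ.ofReal_call hst.le]
  exact (hκ.isPutCurve hr hst k.2).lintegral_deriv_deriv_mul K.2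

end TransitionFunction

/-! ### Joint measurability of second derivatives of convex families -/

/-- The derivatives of a continuous family of differentiable convex functions on `(0, ∞)` are
jointly continuous. -/
theorem continuous_deriv_of_convexOn {X : Type*} [TopologicalSpace X] {F : X → ℝ → ℝ}
    (hc : ∀ k, ConvexOn ℝ (Set.Ioi 0) (F k)) (hd : ∀ k, DifferentiableOn ℝ (F k) (Set.Ioi 0))
    (hF : Continuous fun p : X × ℝ => F p.1 (Real.exp p.2)) :
    Continuous fun p : X × ℝ => deriv (F p.1) (Real.exp p.2) := by
  have hdiff : ∀ k x, 0 < x → DifferentiableAt ℝ (F k) x := fun k x hx =>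
    (hd k x hx).differentiableAt (Ioi_mem_nhds hx)
  have hFv : ∀ v : ℝ, Continuous fun p : X × ℝ => F p.1 (Real.exp v) := fun v =>
    hF.comp (continuous_fst.prodMk continuous_const)
  rw [continuous_iff_continuousAt]
  rintro ⟨k, u⟩
  have hslope : Tendsto (fun v => slope (F k) (Real.exp u) (Real.exp v)) (𝓝[≠] u)
      (𝓝 (deriv (F k) (Real.exp u))) := by
    refine (hasDerivAt_iff_tendsto_slope.1 (hdiff k _ (Real.exp_pos u)).hasDerivAt).comp
      (tendsto_nhdsWithin_iff.2 ⟨?_, ?_⟩)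
    · exact tendsto_nhdsWithin_of_tendsto_nhds (Real.continuous_exp.tendsto u)
    · filter_upwards [self_mem_nhdsWithin] with v hv h
      exact hv (Real.exp_injective h)
  have hcont : ∀ v, v ≠ u → ContinuousAt
      (fun p : X × ℝ => slope (F p.1) (Real.exp p.2) (Real.exp v)) (k, u) := by
    intro v hv
    simp only [slope_def_field]
    refine ContinuousAt.div ((hFv v).sub hF).continuousAt
      (continuous_const.sub (Real.continuous_exp.comp continuous_snd)).continuousAt ?_
    exact sub_ne_zero.2 fun h => hv (Real.exp_injective h)
  -- Slopes from `exp p.2` to a fixed point on its left or right bound the derivative from below or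
  -- above, uniformly in the family by convexity. For a fixed second point the slope is continuous
  -- in `(k, u)`, so a strict bound at `(k, u)` persists nearby.
  refine tendsto_order.2 ⟨fun c hc' => ?_, fun c hc' => ?_⟩
  · have h1 : ∀ᶠ v in 𝓝[<] u, c < slope (F k) (Real.exp u) (Real.exp v) :=
      (hslope.mono_left (nhdsWithin_mono u fun v hv => ne_of_lt hv)).eventually_const_lt hc'
    obtain ⟨v, hv, hvu⟩ := (h1.and self_mem_nhdsWithin).exists
    have hvu : v < u := hvu
    have h2 : ∀ᶠ p : X × ℝ in 𝓝 (k, u), v < p.2 :=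
      continuous_snd.continuousAt.eventually (lt_mem_nhds hvu)
    filter_upwards [(hcont v hvu.ne).eventually (lt_mem_nhds hv), h2] with p hp1 hp2
    refine lt_of_lt_of_le hp1 ?_
    rw [slope_comm]
    exact (hc p.1).slope_le_deriv (Real.exp_pos v) (Real.exp_pos p.2) (Real.exp_lt_exp.2 hp2)
      (hdiff _ _ (Real.exp_pos _))
  · have h1 : ∀ᶠ v in 𝓝[>] u, slope (F k) (Real.exp u) (Real.exp v) < c :=
      (hslope.mono_left (nhdsWithin_mono u fun v hv => ne_of_gt hv)).eventually_lt_const hc'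
    obtain ⟨v, hv, hvu⟩ := (h1.and self_mem_nhdsWithin).exists
    have hvu : u < v := hvu
    have h2 : ∀ᶠ p : X × ℝ in 𝓝 (k, u), p.2 < v :=
      continuous_snd.continuousAt.eventually (gt_mem_nhds hvu)
    filter_upwards [(hcont v hvu.ne').eventually (gt_mem_nhds hv), h2] with p hp1 hp2
    exact lt_of_le_of_lt ((hc p.1).deriv_le_slope (Real.exp_pos p.2) (Real.exp_pos v)
      (Real.exp_lt_exp.2 hp2) (hdiff _ _ (Real.exp_pos _))) hp1

/-- No differentiability is needed: `log` undoes `exp` smoothly, so if `g` is not differentiable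
then neither is the composition, and both sides are the default `0`. -/
theorem deriv_comp_exp (g : ℝ → ℝ) (u : ℝ) :
    deriv (fun v => g (Real.exp v)) u = deriv g (Real.exp u) * Real.exp u := by
  by_cases hg : DifferentiableAt ℝ g (Real.exp u)
  · exact (hg.hasDerivAt.comp u (Real.hasDerivAt_exp u)).deriv
  · rw [deriv_zero_of_not_differentiableAt hg, zero_mul, deriv_zero_of_not_differentiableAt]
    intro h
    refine hg ?_
    have h2 : DifferentiableAt ℝ (fun x => g (Real.exp (Real.log x))) (Real.exp u) := by
      refine DifferentiableAt.comp (g := fun v => g (Real.exp v)) (f := Real.log) (Real.exp u) ?_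
        (Real.differentiableAt_log (Real.exp_ne_zero u))
      rwa [Real.log_exp]
    refine h2.congr_of_eventuallyEq ?_
    filter_upwards [Ioi_mem_nhds (Real.exp_pos u)] with x hx
    rw [Real.exp_log hx]

/-- The second derivatives of a continuous family of differentiable convex functions on `(0, ∞)`
are jointly measurable. -/
theorem measurable_deriv_deriv_of_convexOn {X : Type*} [TopologicalSpace X] [MeasurableSpace X]
    [OpensMeasurableSpace X] {F : X → ℝ → ℝ}
    (hc : ∀ k, ConvexOn ℝ (Set.Ioi 0) (F k)) (hd : ∀ k, DifferentiableOn ℝ (F k) (Set.Ioi 0))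
    (hF : Continuous fun p : X × ℝ => F p.1 (Real.exp p.2)) :
    Measurable fun p : X × Pos => deriv (deriv (F p.1)) (p.2 : ℝ) := by
  -- Measurability of a derivative with a parameter is available for jointly continuous functions on
  -- the whole line, hence the logarithmic spot.
  have h1 := measurable_deriv_with_param (f := fun (k : X) (u : ℝ) => deriv (F k) (Real.exp u))
    (continuous_deriv_of_convexOn hc hd hF)
  have h2 : (fun p : X × Pos => deriv (deriv (F p.1)) (p.2 : ℝ)) = fun p : X × Pos =>
      deriv (fun u => deriv (F p.1) (Real.exp u)) (Real.log (p.2 : ℝ)) / (p.2 : ℝ) := by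
    funext p
    have hp : (0 : ℝ) < p.2 := p.2.2
    rw [deriv_comp_exp, Real.exp_log hp, mul_div_cancel_right₀ _ hp.ne']
  rw [h2]
  have h3 : Measurable fun p : X × Pos => (p.1, Real.log (p.2 : ℝ)) := by fun_prop
  exact (h1.comp h3).div (by fun_prop)

/-! ### The Gamma kernels and the reversed Chapman–Kolmogorov equation -/

namespace TransitionFunction

section

variable {I : Type*} [Preorder I] {κ : TransitionFunction I} {s t : I}

/-- Without joint measurability, `Kernel.withDensity` in `gammaKernel` would be the default kernel
`0`. -/
theorem SpotRegular.measurable_gammaDensity (hr : κ.SpotRegular) (hst : s < t) :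
    Measurable (Function.uncurry (κ.gammaDensity s t)) := by
  refine ENNReal.measurable_ofReal.comp ?_
  refine measurable_deriv_deriv_of_convexOn (X := Pos) (F := fun k x => κ.put s t k x)
    (fun k => hr.convex s t hst k k.2) (fun k => hr.differentiable s t hst k k.2) ?_
  refine continuous_prod_of_continuous_lipschitzWith _ 1 (fun k => ?_) fun u => ?_
  · exact (hr.differentiable s t hst k k.2).continuousOn.comp_continuous Real.continuous_exp
      fun u => Real.exp_pos u
  · have := (lipschitzWith_put (κ := κ) hst.le (Real.exp u)).comp
      (LipschitzWith.subtype_val (Set.Ioi (0 : ℝ)))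
    rwa [mul_one] at this

/-- The reverse `Γ`-adjoint transition law `Γ_{s,t}(k | k') dk'`. -/
noncomputable def gammaKernel (κ : TransitionFunction I) (s t : I) : Kernel Pos Pos :=
  Kernel.withDensity (Kernel.const Pos (volume : Measure Pos)) (κ.gammaDensity s t)

theorem SpotRegular.gammaKernel_apply (hr : κ.SpotRegular) (hst : s < t) (k : Pos) :
    κ.gammaKernel s t k = (volume : Measure Pos).withDensity (κ.gammaDensity s t k) :=
  Kernel.withDensity_apply _ (hr.measurable_gammaDensity hst) k

theorem IsMartingale.isMarkovKernel_gammaKernel (hκ : κ.IsMartingale) (hr : κ.SpotRegular)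
    (hst : s < t) : IsMarkovKernel (κ.gammaKernel s t) := by
  refine ⟨fun k => ⟨?_⟩⟩
  rw [hr.gammaKernel_apply hst, withDensity_apply _ MeasurableSet.univ, Measure.restrict_univ,
    hκ.lintegral_gammaDensity hr hst]

theorem IsMartingale.lintegral_gammaKernel (hκ : κ.IsMartingale) (hr : κ.SpotRegular)
    (hst : s < t) (k K : Pos) :
    ∫⁻ k', ENNReal.ofReal ((K : ℝ) - k') ∂(κ.gammaKernel s t k)
      = ∫⁻ y, ENNReal.ofReal ((y : ℝ) - k) ∂(κ.kernel s t K) := by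
  rw [← hκ.lintegral_gammaDensity_mul hr hst, gammaKernel,
    Kernel.lintegral_withDensity _ (hr.measurable_gammaDensity hst) k (by fun_prop),
    Kernel.const_apply]

/-- The reversed Chapman–Kolmogorov equation for the laws `Γ_{s,t}(k | k') dk'`. -/
theorem IsMartingale.gammaKernel_comp (hκ : κ.IsMartingale) (hr : κ.SpotRegular) {u : I}
    (hst : s < t) (htu : t < u) :
    κ.gammaKernel s t ∘ₖ κ.gammaKernel t u = κ.gammaKernel s u := by
  have h1 := hκ.isMarkovKernel_gammaKernel hr hst
  have h2 := hκ.isMarkovKernel_gammaKernel hr htu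
  have h3 := hκ.isMarkovKernel_gammaKernel hr (hst.trans htu)
  have h4 := κ.markov s t hst.le
  ext1 k
  refine measure_pos_ext_of_put fun K hK => ?_
  lift K to Pos using hK
  rw [hκ.lintegral_gammaKernel hr (hst.trans htu), ← κ.chapman_kolmogorov s t u hst.le htu.le,
    Kernel.lintegral_comp _ _ _ (by fun_prop), Kernel.lintegral_comp _ _ _ (by fun_prop)]
  -- After applying duality to both sides, each is the double integral of `(y - k')⁺` against
  -- `κ.kernel s t K` in `y` and `κ.gammaKernel t u k` in `k'`, in opposite orders.
  simp_rw [hκ.lintegral_gammaKernel hr hst, ← hκ.lintegral_gammaKernel hr htu]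
  exact lintegral_lintegral_swap (by fun_prop)

/-- The reversed Chapman–Kolmogorov equation for the densities `Γ_{s,t}(k | k')`. -/
theorem IsMartingale.gammaDensity_chapman_kolmogorov (hκ : κ.IsMartingale) (hr : κ.SpotRegular)
    {u : I} (hst : s < t) (htu : t < u) (k : Pos) :
    ∀ᵐ k'' : Pos, κ.gammaDensity s u k k''
      = ∫⁻ k' : Pos, κ.gammaDensity t u k k' * κ.gammaDensity s t k' k'' := by
  have hm1 := hr.measurable_gammaDensity hst
  have hm2 := hr.measurable_gammaDensity htu
  have hm3 := hr.measurable_gammaDensity (hst.trans htu)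
  have hm2k : Measurable (κ.gammaDensity t u k) := hm2.of_uncurry_left
  have hjoint : Measurable (Function.uncurry fun k' k'' : Pos =>
      κ.gammaDensity t u k k' * κ.gammaDensity s t k' k'') :=
    (hm2k.comp measurable_fst).mul hm1
  -- Densities of the same measure agree almost everywhere, so the identity of kernels already
  -- proved is enough.
  refine (withDensity_eq_iff_of_sigmaFinite (hm3.of_uncurry_left).aemeasurable
    (Measurable.lintegral_prod_left' hjoint).aemeasurable).1 ?_
  rw [← hr.gammaKernel_apply (hst.trans htu), ← hκ.gammaKernel_comp hr hst htu]
  ext B hB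
  rw [Kernel.comp_apply' _ _ _ hB, gammaKernel, gammaKernel,
    Kernel.lintegral_withDensity _ hm2 k (Kernel.measurable_coe _ hB), Kernel.const_apply,
    withDensity_apply _ hB, ← lintegral_lintegral_swap (by exact hjoint.aemeasurable)]
  refine lintegral_congr fun k' => ?_
  rw [Kernel.withDensity_apply' _ hm1, Kernel.const_apply]
  exact (lintegral_const_mul _ hm1.of_uncurry_left).symm

end

end TransitionFunction

theorem ReversibleTimes.rev_lt_rev (𝒯 : ReversibleTimes) {t t' : 𝒯.times} (h : t < t') :
    𝒯.rev t' < 𝒯.rev t :=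
  Subtype.coe_lt_coe.1 (sub_lt_sub_left (Subtype.coe_lt_coe.2 h) 𝒯.horizon)

namespace TransitionFunction

open scoped Classical in
/-- The reverse `Γ`-adjoint transition function. -/
noncomputable def reverseGammaAdjoint {𝒯 : ReversibleTimes} (κ : TransitionFunction 𝒯.times)
    (hκ : κ.IsMartingale) (hr : κ.SpotRegular) : TransitionFunction 𝒯.times where
  kernel t t' := if t < t' then κ.gammaKernel (𝒯.rev t') (𝒯.rev t) else Kernel.id
  markov t t' htt' := by
    split_ifs with h
    · exact hκ.isMarkovKernel_gammaKernel hr (𝒯.rev_lt_rev h)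
    · infer_instance
  refl t := if_neg (lt_irrefl t)
  chapman_kolmogorov t t' t'' h h' := by
    rcases h.eq_or_lt with rfl | h1
    · simp
    rcases h'.eq_or_lt with rfl | h2
    · simp
    rw [if_pos h1, if_pos h2, if_pos (h1.trans h2)]
    exact hκ.gammaKernel_comp hr (𝒯.rev_lt_rev h2) (𝒯.rev_lt_rev h1)

theorem isReverseGammaAdjointKernel_reverseGammaAdjoint {𝒯 : ReversibleTimes}
    (κ : TransitionFunction 𝒯.times) (hκ : κ.IsMartingale) (hr : κ.SpotRegular) :
    IsReverseGammaAdjointKernel κ (κ.reverseGammaAdjoint hκ hr) := by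
  intro t t' h k
  have hlt := 𝒯.rev_lt_rev h
  refine ⟨Eventually.of_forall fun k' =>
    (hr.convex _ _ hlt k k.2).deriv_deriv_nonneg (hr.differentiable _ _ hlt k k.2) k'.2, ?_⟩
  have hk : (κ.reverseGammaAdjoint hκ hr).kernel t t' = κ.gammaKernel (𝒯.rev t') (𝒯.rev t) :=
    if_pos h
  rw [hk]
  exact hr.gammaKernel_apply hlt k

end TransitionFunction

/-! ### Returns with a fixed law: Delta, Gamma and the dual law -/

/-- Multiplication of positive prices. -/
noncomputable def mulPos (x y : Pos) : Pos := ⟨(x : ℝ) * y, Set.mem_Ioi.2 (mul_pos (Set.mem_Ioi.1 x.2) (Set.mem_Ioi.1 y.2))⟩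

/-- Division of positive prices. -/
noncomputable def divPos (x y : Pos) : Pos := ⟨(x : ℝ) / y, Set.mem_Ioi.2 (div_pos (Set.mem_Ioi.1 x.2) (Set.mem_Ioi.1 y.2))⟩

theorem coe_mulPos (x y : Pos) : (mulPos x y : ℝ) = x * y := rfl

theorem coe_divPos (x y : Pos) : (divPos x y : ℝ) = x / y := rfl

theorem divPos_mulPos_cancel (x y : Pos) : divPos (mulPos x y) x = y :=
  Subtype.ext (mul_div_cancel_left₀ (y : ℝ) (ne_of_gt x.2))

theorem measurable_mulPos (x : Pos) : Measurable (mulPos x) :=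
  Measurable.subtype_mk (by fun_prop)

theorem measurable_divPos (x : Pos) : Measurable (divPos x) :=
  Measurable.subtype_mk (by fun_prop)

theorem measurable_divPos_prod : Measurable fun p : Pos × Pos => divPos p.2 p.1 :=
  Measurable.subtype_mk (by fun_prop)

theorem AbsolutelyContinuousOnInterval.congr {f g : ℝ → ℝ} {a b : ℝ}
    (hf : AbsolutelyContinuousOnInterval f a b) (h : Set.EqOn f g (Set.uIcc a b)) :
    AbsolutelyContinuousOnInterval g a b := by
  rw [absolutelyContinuousOnInterval_iff] at hf ⊢
  intro ε hε
  obtain ⟨δ, hδ, H⟩ := hf ε hε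
  refine ⟨δ, hδ, fun E hE hlt => ?_⟩
  rw [← Finset.sum_congr rfl fun i hi => ?_]
  · exact H E hE hlt
  · rw [h (hE.1 i hi).1, h (hE.1 i hi).2]

/-- A smooth image of a null set under a continuous law is a null set. -/
theorem measure_eq_zero_of_leftInvOn {μ : Measure Pos} (hμ : μ ≪ (volume : Measure Pos))
    {f g : ℝ → ℝ} (hfg : ∀ y, 0 < y → g (f y) = y) {N : Set ℝ}
    (hg : DifferentiableOn ℝ g N) (hN : volume N = 0) :
    μ {y : Pos | f y ∈ N} = 0 := by
  refine hμ ?_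
  have h1 : volume (g '' N) = 0 :=
    addHaar_image_eq_zero_of_differentiableOn_of_addHaar_eq_zero volume hg hN
  have h2 : (volume : Measure Pos) (Subtype.val ⁻¹' (g '' N)) = 0 := by
    refine measure_mono_null (Set.preimage_mono (subset_toMeasurable volume _)) ?_
    rw [← Measure.map_apply measurable_subtype_coe (measurableSet_toMeasurable _ _),
      map_val_volume_pos]
    refine measure_mono_null (Set.Subset.refl _) (Measure.absolutelyContinuous_of_le
      Measure.restrict_le_self ?_)
    rwa [measure_toMeasurable]
  refine measure_mono_null (fun (y : Pos) (hy : f y ∈ N) => ?_) h2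
  exact ⟨f y, hy, hfg y y.2⟩

/-- The put value as a function of the spot, if the spot is multiplied by a factor with law `μ`. -/
noncomputable def scaledPut (μ : Measure Pos) (k x : ℝ) : ℝ := ∫ y, max (k - x * (y : ℝ)) 0 ∂μ

/-- The law of `k / Y`, with `Y` distributed according to `μ` weighted by its mean. -/
noncomputable def dualLaw (k : Pos) (μ : Measure Pos) : Measure Pos :=
  (μ.withDensity fun y => ENNReal.ofReal (y : ℝ)).map (divPos k)

theorem lintegral_dualLaw (k : Pos) (μ : Measure Pos) {g : Pos → ℝ≥0∞} (hg : Measurable g) :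
    ∫⁻ z, g z ∂(dualLaw k μ) = ∫⁻ y, ENNReal.ofReal (y : ℝ) * g (divPos k y) ∂μ := by
  rw [dualLaw, lintegral_map hg (measurable_divPos k),
    lintegral_withDensity_eq_lintegral_mul _ (by fun_prop)
      (g := fun y => g (divPos k y)) (hg.comp (measurable_divPos k))]
  rfl

theorem absolutelyContinuous_map_dualLaw {μ : Measure Pos} (hμ : μ ≪ (volume : Measure Pos)) (k : Pos) :
    (dualLaw k μ).map Subtype.val ≪ (volume : Measure ℝ) := by
  refine Measure.AbsolutelyContinuous.mk fun N hN hN0 => ?_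
  have hk : (0 : ℝ) < k := k.2
  rw [Measure.map_apply measurable_subtype_coe hN, dualLaw,
    Measure.map_apply (measurable_divPos k) (measurable_subtype_coe hN)]
  refine withDensity_absolutelyContinuous _ _ ?_
  -- The map `y ↦ k / y` is its own inverse. The point `0` is removed from `N` since the map is not
  -- differentiable there; no value `k / y` equals `0`.
  have h := measure_eq_zero_of_leftInvOn hμ (f := fun y => (k : ℝ) / y) (g := fun y => (k : ℝ) / y)
    (N := N \ {0}) (fun y hy => by field_simp) ?_ (measure_mono_null Set.sdiff_subset hN0)
  · refine measure_mono_null (fun (y : Pos) (hy : (k : ℝ) / y ∈ N) => ?_) h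
    exact ⟨hy, ne_of_gt (div_pos hk y.2)⟩
  · intro y hy
    exact ((differentiableAt_const (k : ℝ)).div differentiableAt_id (x := y)
      hy.2).differentiableWithinAt

section ScaledPut

variable (μ : Measure Pos) [IsFiniteMeasure μ] {k : ℝ}

theorem integrable_scaledPut {x : ℝ} (hx : 0 < x) :
    Integrable (fun y : Pos => max (k - x * (y : ℝ)) 0) μ := by
  refine Integrable.of_bound (by fun_prop) |k| (Eventually.of_forall fun y => ?_)
  have hy : 0 < x * (y : ℝ) := mul_pos hx y.2
  rw [Real.norm_of_nonneg (le_max_right _ _)]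
  exact max_le (by linarith [le_abs_self k]) (abs_nonneg k)

theorem convexOn_scaledPut : ConvexOn ℝ (Set.Ioi 0) (scaledPut μ k) := by
  refine ⟨convex_Ioi 0, fun x hx x' hx' a b ha hb hab => ?_⟩
  have hpos : 0 < a • x + b • x' := (convex_Ioi (0 : ℝ)) hx hx' ha hb hab
  simp only [scaledPut, smul_eq_mul] at hpos ⊢
  rw [← integral_const_mul, ← integral_const_mul, ← integral_add
    ((integrable_scaledPut μ hx).const_mul a) ((integrable_scaledPut μ hx').const_mul b)]
  refine integral_mono (integrable_scaledPut μ hpos)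
    (((integrable_scaledPut μ hx).const_mul a).add ((integrable_scaledPut μ hx').const_mul b))
    fun y => ?_
  have h1 := mul_le_mul_of_nonneg_left (le_max_left (k - x * (y : ℝ)) 0) ha
  have h2 := mul_le_mul_of_nonneg_left (le_max_left (k - x' * (y : ℝ)) 0) hb
  have h3 := mul_nonneg ha (le_max_right (k - x * (y : ℝ)) 0)
  have h4 := mul_nonneg hb (le_max_right (k - x' * (y : ℝ)) 0)
  refine max_le ?_ (add_nonneg h3 h4)
  have : k - (a * x + b * x') * (y : ℝ) = a * (k - x * y) + b * (k - x' * y) := by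
    linear_combination (-k) * hab
  simp only
  linarith

theorem measurableSet_mul_lt (k x : ℝ) : MeasurableSet {y : Pos | x * (y : ℝ) < k} :=
  measurableSet_lt (by fun_prop) measurable_const

theorem integrable_indicator_mul_lt {x : ℝ} (hx : 0 < x) :
    Integrable ({y : Pos | x * (y : ℝ) < k}.indicator fun y : Pos => (y : ℝ)) μ := by
  refine Integrable.of_bound ((by fun_prop : Measurable fun y : Pos => (y : ℝ)).indicator
    (measurableSet_mul_lt k x)).aestronglyMeasurable (|k| / x) (Eventually.of_forall fun y => ?_)
  by_cases hy : x * (y : ℝ) < k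
  · have h0 : (0 : ℝ) < y := y.2
    rw [Set.indicator_of_mem (by exact hy), Real.norm_of_nonneg h0.le, le_div_iff₀ hx]
    linarith [le_abs_self k]
  · rw [Set.indicator_of_notMem (by exact hy), norm_zero]
    positivity

variable {μ}

/-- Differentiation under the integral. The kink of the payoff sits at `y = k / x`, a null set
because the law is continuous; no moment of `μ` is needed. -/
theorem hasDerivAt_scaledPut (hμ : μ ≪ (volume : Measure Pos)) {x : ℝ} (hx : 0 < x) :
    HasDerivAt (scaledPut μ k)
      (-∫ y, {y : Pos | x * (y : ℝ) < k}.indicator (fun y : Pos => (y : ℝ)) y ∂μ) x := by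
  rw [← integral_neg]
  have hi : Integrable (fun y : Pos =>
      -{y : Pos | x * (y : ℝ) < k}.indicator (fun y : Pos => (y : ℝ)) y) μ :=
    (integrable_indicator_mul_lt μ hx).neg
  have hx2 : 0 < x / 2 := half_pos hx
  refine (hasDerivAt_integral_of_dominated_loc_of_lip (s := Set.Ioi (x / 2))
    -- For spots above `x / 2` the payoff vanishes unless `y ≤ 2 |k| / x`, and for such `y` it is
    -- Lipschitz in the spot with constant `y`.
    (bound := fun _ => 2 * |k| / x) (Ioi_mem_nhds (by linarith))
    (Eventually.of_forall fun x => by fun_prop) (integrable_scaledPut μ hx)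
    hi.aestronglyMeasurable
    (Eventually.of_forall fun y => ?_) (integrable_const _) ?_).2
  · have hy0 : (0 : ℝ) < y := y.2
    have hb : 0 ≤ 2 * |k| / x := by positivity
    refine LipschitzOnWith.of_dist_le_mul fun a ha b hb' => ?_
    have ha : x / 2 < a := ha
    have hb' : x / 2 < b := hb'
    rw [Real.coe_nnabs, abs_of_nonneg hb, Real.dist_eq, Real.dist_eq]
    by_cases hy : x / 2 * (y : ℝ) ≤ |k|
    · refine (abs_max_sub_max_le_abs _ _ _).trans ?_
      rw [show k - a * (y : ℝ) - (k - b * y) = -((y : ℝ) * (a - b)) by ring, abs_neg, abs_mul,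
        abs_of_pos hy0]
      refine mul_le_mul_of_nonneg_right ?_ (abs_nonneg _)
      rw [le_div_iff₀ hx]
      linarith
    · have hk := le_abs_self k
      have h1 : x / 2 * (y : ℝ) < a * y := mul_lt_mul_of_pos_right ha hy0
      have h2 : x / 2 * (y : ℝ) < b * y := mul_lt_mul_of_pos_right hb' hy0
      rw [max_eq_right (by linarith), max_eq_right (by linarith), sub_zero, abs_zero]
      positivity
  · have hnull : μ {y : Pos | (y : ℝ) ∈ ({k / x} : Set ℝ)} = 0 :=
      measure_eq_zero_of_leftInvOn hμ (f := fun y => y) (g := fun y => y) (fun _ _ => rfl)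
        differentiableOn_id (measure_singleton _)
    have hae : ∀ᵐ y : Pos ∂μ, (y : ℝ) ≠ k / x := by
      rw [ae_iff]
      simpa using hnull
    filter_upwards [hae] with y hy
    have hlin : HasDerivAt (fun x : ℝ => k - x * (y : ℝ)) (-(y : ℝ)) x := by
      simpa using ((hasDerivAt_id x).mul_const (y : ℝ)).const_sub k
    rcases lt_trichotomy (x * (y : ℝ)) k with h | h | h
    · rw [Set.indicator_of_mem (by exact h)]
      refine hlin.congr_of_eventuallyEq ?_
      have : ∀ᶠ z in 𝓝 x, z * (y : ℝ) < k :=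
        (continuous_id.mul continuous_const).continuousAt.eventually (gt_mem_nhds h)
      filter_upwards [this] with z hz
      exact max_eq_left (by linarith)
    · exact absurd ((eq_div_iff hx.ne').2 (by linarith)) hy
    · rw [Set.indicator_of_notMem (show y ∉ {y : Pos | x * (y : ℝ) < k} from not_lt.2 h.le), neg_zero]
      refine (hasDerivAt_const x (0 : ℝ)).congr_of_eventuallyEq ?_
      have : ∀ᶠ z in 𝓝 x, k < z * (y : ℝ) :=
        (continuous_id.mul continuous_const).continuousAt.eventually (lt_mem_nhds h)
      filter_upwards [this] with z hz
      exact max_eq_right (by linarith)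

/-- The event `a < k / y ≤ b` means `a y < k` but not `b y < k`. Weighted by `y`, its mass is
therefore a difference of two Deltas. -/
theorem dualLaw_Ioc (hμ : μ ≪ (volume : Measure Pos)) (k a b : Pos) (hab : a ≤ b) :
    dualLaw k μ (Set.Ioc a b)
      = ENNReal.ofReal (deriv (scaledPut μ k) b - deriv (scaledPut μ k) a) := by
  have ha : (0 : ℝ) < a := a.2
  have hb : (0 : ℝ) < b := b.2
  have hab' : (a : ℝ) ≤ b := hab
  have hle : ∀ y : Pos, {y : Pos | (b : ℝ) * y < k}.indicator (fun y : Pos => (y : ℝ)) y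
      ≤ {y : Pos | (a : ℝ) * y < k}.indicator (fun y : Pos => (y : ℝ)) y := by
    intro y
    refine Set.indicator_le_indicator_of_subset (fun y hy => ?_) (fun y => le_of_lt y.2) y
    exact lt_of_le_of_lt (mul_le_mul_of_nonneg_right hab' (le_of_lt y.2)) hy
  have hi : Integrable (fun y => {y : Pos | (a : ℝ) * y < k}.indicator (fun y : Pos => (y : ℝ)) y
      - {y : Pos | (b : ℝ) * y < k}.indicator (fun y : Pos => (y : ℝ)) y) μ :=
    (integrable_indicator_mul_lt μ ha).sub (integrable_indicator_mul_lt μ hb)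
  rw [(hasDerivAt_scaledPut hμ ha).deriv, (hasDerivAt_scaledPut hμ hb).deriv, neg_sub_neg,
    ← integral_sub (integrable_indicator_mul_lt μ ha) (integrable_indicator_mul_lt μ hb),
    ofReal_integral_eq_lintegral_ofReal hi (Eventually.of_forall fun y => sub_nonneg.2 (hle y)),
    ← lintegral_indicator_one measurableSet_Ioc,
    lintegral_dualLaw _ _ (measurable_one.indicator measurableSet_Ioc)]
  refine lintegral_congr fun y => ?_
  have hy : (0 : ℝ) < y := y.2
  have h1 : divPos k y ∈ Set.Ioc a b ↔ (a : ℝ) * y < k ∧ ¬ (b : ℝ) * y < k := by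
    rw [Set.mem_Ioc, ← Subtype.coe_lt_coe, ← Subtype.coe_le_coe, coe_divPos, lt_div_iff₀ hy,
      div_le_iff₀ hy, not_lt]
  by_cases hya : (a : ℝ) * y < k
  · by_cases hyb : (b : ℝ) * y < k
    · rw [Set.indicator_of_notMem (by rw [h1]; tauto), Set.indicator_of_mem (by exact hya),
        Set.indicator_of_mem (by exact hyb)]
      simp
    · rw [Set.indicator_of_mem (h1.2 ⟨hya, hyb⟩), Set.indicator_of_mem (by exact hya),
        Set.indicator_of_notMem (by exact hyb)]
      simp
  · have hyb : ¬ (b : ℝ) * y < k := fun h =>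
      hya (lt_of_le_of_lt (mul_le_mul_of_nonneg_right hab' hy.le) h)
    rw [Set.indicator_of_notMem (by rw [h1]; tauto), Set.indicator_of_notMem (by exact hya),
      Set.indicator_of_notMem (by exact hyb)]
    simp

theorem deriv_scaledPut_mono (hμ : μ ≪ (volume : Measure Pos)) {a b : ℝ} (ha : 0 < a)
    (hab : a ≤ b) : deriv (scaledPut μ k) a ≤ deriv (scaledPut μ k) b :=
  (convexOn_scaledPut μ).monotoneOn_deriv (fun _ hx => (hasDerivAt_scaledPut hμ hx).differentiableAt)
    (Set.mem_Ioi.2 ha) (Set.mem_Ioi.2 (ha.trans_le hab)) hab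

/-- Increments of the Delta are masses of the dual law, which has a Lebesgue density, so the Delta
is an indefinite integral. -/
theorem absolutelyContinuousOnInterval_deriv_scaledPut (hμ : μ ≪ (volume : Measure Pos))
    (hk : 0 < k) {a b : ℝ} (ha : 0 < a) (hab : a ≤ b) :
    AbsolutelyContinuousOnInterval (deriv (scaledPut μ k)) a b := by
  lift k to Pos using hk
  set M : Measure ℝ := (dualLaw k μ).map Subtype.val with hM
  have hsf : SFinite M := by
    rw [hM, dualLaw]
    infer_instance
  set g := M.rnDeriv volume with hg
  have hgM : volume.withDensity g = M :=
    Measure.withDensity_rnDeriv_eq _ _ (absolutelyContinuous_map_dualLaw hμ k)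
  have hval : ∀ x, a ≤ x → ∫⁻ z in Set.Ioc a x, g z
      = ENNReal.ofReal (deriv (scaledPut μ k) x - deriv (scaledPut μ k) a) := by
    intro x hax
    rw [← withDensity_apply _ measurableSet_Ioc, hgM, hM,
      Measure.map_apply measurable_subtype_coe measurableSet_Ioc]
    exact dualLaw_Ioc hμ k ⟨a, ha⟩ ⟨x, ha.trans_le hax⟩ hax
  have hfin : ∫⁻ z in Set.Ioc a b, g z ≠ ∞ := by
    rw [hval b hab]
    exact ENNReal.ofReal_ne_top
  have hint : IntervalIntegrable (fun z => (g z).toReal) volume a b := by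
    rw [intervalIntegrable_iff_integrableOn_Ioc_of_le hab]
    exact integrable_toReal_of_lintegral_ne_top
      (Measure.measurable_rnDeriv _ _).aemeasurable hfin
  have hac := hint.absolutelyContinuousOnInterval_intervalIntegral (c := a) Set.left_mem_uIcc
  have hconst : AbsolutelyContinuousOnInterval (fun _ : ℝ => deriv (scaledPut μ k) a) a b :=
    contDiffOn_const.absolutelyContinuousOnInterval
  refine (hac.add hconst).congr fun x hx => ?_
  rw [Set.uIcc_of_le hab] at hx
  have hax := hval x hx.1
  have hlt : ∀ᵐ z ∂(volume.restrict (Set.Ioc a x)), g z < ∞ :=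
    ae_lt_top (Measure.measurable_rnDeriv _ _) (by rw [hax]; exact ENNReal.ofReal_ne_top)
  rw [Pi.add_apply, intervalIntegral.integral_of_le hx.1,
    integral_toReal (Measure.measurable_rnDeriv _ _).aemeasurable hlt, hax,
    ENNReal.toReal_ofReal (sub_nonneg.2 (deriv_scaledPut_mono hμ ha hx.1)), sub_add_cancel]

theorem tendsto_scaledPut_atTop (hk : 0 < k) : Tendsto (scaledPut μ k) atTop (𝓝 0) := by
  have h : Tendsto (fun x => ∫ y : Pos, max (k - x * (y : ℝ)) 0 ∂μ) atTop
      (𝓝 (∫ _ : Pos, (0 : ℝ) ∂μ)) := by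
    refine tendsto_integral_filter_of_dominated_convergence (fun _ => k)
      (Eventually.of_forall fun x => by fun_prop) ?_ (integrable_const _)
      (Eventually.of_forall fun y => ?_)
    · filter_upwards [eventually_gt_atTop 0] with x hx
      refine Eventually.of_forall fun y => ?_
      have hy : 0 < x * (y : ℝ) := mul_pos hx y.2
      rw [Real.norm_of_nonneg (le_max_right _ _)]
      exact max_le (by linarith) hk.le
    · refine tendsto_const_nhds.congr' ?_
      filter_upwards [eventually_ge_atTop (k / y)] with x hx
      rw [div_le_iff₀ y.2] at hx
      rw [max_eq_right (by linarith)]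
  rwa [integral_zero] at h

/-- For a continuous factor with law `μ`, the law of density `Γ(k | ·)` is the dual law. -/
theorem withDensity_deriv_deriv_scaledPut (hμ : μ ≪ (volume : Measure Pos)) (k : Pos) :
    (volume : Measure Pos).withDensity
      (fun x => ENNReal.ofReal (deriv (deriv (scaledPut μ k)) (x : ℝ))) = dualLaw k μ := by
  have hIoc : ∀ a b : Pos, a < b → (volume : Measure Pos).withDensity
      (fun x => ENNReal.ofReal (deriv (deriv (scaledPut μ k)) (x : ℝ))) (Set.Ioc a b)
        = ENNReal.ofReal (deriv (scaledPut μ k) b - deriv (scaledPut μ k) a) := by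
    intro a b hab
    have hab' : (a : ℝ) ≤ b := hab.le
    rw [withDensity_apply _ measurableSet_Ioc, ← lintegral_indicator measurableSet_Ioc,
      ← setLIntegral_deriv_deriv_Ioc (convexOn_scaledPut μ)
        (fun x hx => (hasDerivAt_scaledPut hμ hx).differentiableAt.differentiableWithinAt) a.2 hab'
        (absolutelyContinuousOnInterval_deriv_scaledPut hμ k.2 a.2 hab'),
      ← lintegral_indicator measurableSet_Ioc]
    refine Eq.trans ?_ ((lintegral_pos ((Set.Ioc (a : ℝ) b).indicator fun x =>
      ENNReal.ofReal (deriv (deriv (scaledPut μ k)) x))).trans ?_)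
    · rfl
    · rw [← lintegral_indicator measurableSet_Ioi]
      have hsub : Set.Ioc (a : ℝ) b ⊆ Set.Ioi 0 := fun x hx => lt_trans (Set.mem_Ioi.1 a.2) hx.1
      rw [Set.indicator_indicator, Set.inter_eq_right.2 hsub]
  refine Measure.ext_of_Ioc' _ _ (fun a b hab => ?_) fun a b hab => ?_
  · rw [hIoc a b hab]
    exact ENNReal.ofReal_ne_top
  · rw [hIoc a b hab, dualLaw_Ioc hμ k a b hab.le]

end ScaledPut

/-- The price `1`. -/
noncomputable def onePos : Pos := ⟨1, Set.mem_Ioi.2 one_pos⟩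

theorem mulPos_onePos : mulPos onePos = id := by
  funext y
  exact Subtype.ext (one_mul (y : ℝ))

theorem mulPos_divPos_onePos (k y : Pos) : mulPos k (divPos onePos y) = divPos k y :=
  Subtype.ext (mul_one_div (k : ℝ) (y : ℝ))

theorem dualLaw_eq_map (k : Pos) (μ : Measure Pos) :
    dualLaw k μ = (dualLaw onePos μ).map (mulPos k) := by
  rw [dualLaw, dualLaw, Measure.map_map (measurable_mulPos k) (measurable_divPos onePos)]
  congr 1
  funext y
  exact (mulPos_divPos_onePos k y).symm

/-- In particular, the dual law is a probability exactly when `μ` has mean one. -/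
theorem dualLaw_univ (k : Pos) (μ : Measure Pos) :
    dualLaw k μ Set.univ = ∫⁻ y, ENNReal.ofReal (y : ℝ) ∂μ := by
  rw [dualLaw, Measure.map_apply (measurable_divPos k) MeasurableSet.univ, Set.preimage_univ,
    withDensity_apply _ MeasurableSet.univ, Measure.restrict_univ]

theorem integrable_coe_of_lintegral {η : Measure Pos} {x : ℝ} (hx : 0 ≤ x)
    (h : ∫⁻ y, ENNReal.ofReal (y : ℝ) ∂η = ENNReal.ofReal x) :
    Integrable (fun y : Pos => (y : ℝ)) η ∧ ∫ y, (y : ℝ) ∂η = x := by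
  have hnn : 0 ≤ᵐ[η] fun y : Pos => (y : ℝ) := Eventually.of_forall fun y => le_of_lt y.2
  refine ⟨⟨by fun_prop, (hasFiniteIntegral_iff_ofReal hnn).2 ?_⟩, ?_⟩
  · rw [h]
    exact ENNReal.ofReal_lt_top
  · rw [integral_eq_lintegral_of_nonneg_ae hnn (by fun_prop), h, ENNReal.toReal_ofReal hx]

theorem lintegral_coe_of_integrable {η : Measure Pos} (hi : Integrable (fun y : Pos => (y : ℝ)) η) :
    ∫⁻ y, ENNReal.ofReal (y : ℝ) ∂η = ENNReal.ofReal (∫ y, (y : ℝ) ∂η) :=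
  (ofReal_integral_eq_lintegral_ofReal hi (Eventually.of_forall fun y => le_of_lt y.2)).symm

/-! ### Consequences of the scaling property -/

namespace TransitionFunction

section

variable {I : Type*} [Preorder I] {κ : TransitionFunction I} {s t : I} {μ : Measure Pos}

/-- The return between the times `s` and `t` has law `μ`, whatever the spot value. -/
def HasRatioLaw (κ : TransitionFunction I) (s t : I) (μ : Measure Pos) : Prop :=
  ∀ x : Pos, κ.kernel s t x = μ.map (mulPos x)

theorem HasRatioLaw.put_eq (h : κ.HasRatioLaw s t μ) (k : ℝ) {x : ℝ} (hx : 0 < x) :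
    κ.put s t k x = scaledPut μ k x := by
  refine (κ.put_coe s t k ⟨x, hx⟩).trans ?_
  rw [h, integral_map (measurable_mulPos _).aemeasurable (by fun_prop)]
  rfl

theorem HasRatioLaw.call_eq (h : κ.HasRatioLaw s t μ) (k : ℝ) {x : ℝ} (hx : 0 < x) :
    κ.call s t k x = ∫ y, max (x * (y : ℝ) - k) 0 ∂μ := by
  refine (κ.call_coe s t k ⟨x, hx⟩).trans ?_
  rw [h, integral_map (measurable_mulPos _).aemeasurable (by fun_prop)]
  rfl

theorem HasRatioLaw.put_mul (h : κ.HasRatioLaw s t μ) {α x : ℝ} (K : ℝ) (hα : 0 < α)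
    (hx : 0 < x) : κ.put s t (α * K) (α * x) = α * κ.put s t K x := by
  rw [h.put_eq _ (mul_pos hα hx), h.put_eq _ hx, scaledPut, scaledPut, ← integral_const_mul]
  refine integral_congr_ae (Eventually.of_forall fun y => ?_)
  simp only
  rw [mul_max_of_nonneg _ _ hα.le, mul_zero]
  congr 1
  ring

theorem HasRatioLaw.eqOn_deriv_put (h : κ.HasRatioLaw s t μ) (k : ℝ) :
    Set.EqOn (deriv (κ.put s t k)) (deriv (scaledPut μ k)) (Set.Ioi 0) := by
  intro x hx
  refine Filter.EventuallyEq.deriv_eq ?_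
  filter_upwards [Ioi_mem_nhds hx] with z hz
  exact h.put_eq k hz

theorem HasRatioLaw.gamma_eq (h : κ.HasRatioLaw s t μ) (k : ℝ) {x : ℝ} (hx : 0 < x) :
    κ.gamma s t k x = deriv (deriv (scaledPut μ k)) x := by
  refine Filter.EventuallyEq.deriv_eq ?_
  filter_upwards [Ioi_mem_nhds hx] with z hz
  exact h.eqOn_deriv_put k hz

theorem HasRatioLaw.withDensity_gamma [IsFiniteMeasure μ] (h : κ.HasRatioLaw s t μ)
    (hμ : μ ≪ (volume : Measure Pos)) (k : Pos) :
    (volume : Measure Pos).withDensity (fun k' => ENNReal.ofReal (κ.gamma s t k k'))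
      = dualLaw k μ := by
  rw [← withDensity_deriv_deriv_scaledPut hμ k]
  congr 1
  funext k'
  rw [h.gamma_eq k k'.2]

theorem HasRatioLaw.lintegral_coe (h : κ.HasRatioLaw s t μ) (x : Pos) :
    ∫⁻ y, ENNReal.ofReal (y : ℝ) ∂(κ.kernel s t x)
      = ENNReal.ofReal x * ∫⁻ y, ENNReal.ofReal (y : ℝ) ∂μ := by
  rw [h, lintegral_map (by fun_prop) (measurable_mulPos x), ← lintegral_const_mul _ (by fun_prop)]
  refine lintegral_congr fun y => ?_
  rw [coe_mulPos, ENNReal.ofReal_mul (le_of_lt x.2)]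

/-- Under the scaling property, the return over a time interval does not depend on the spot. -/
theorem ScalingProperty.hasRatioLaw (hs : κ.ScalingProperty) (hst : s < t) :
    κ.HasRatioLaw s t (κ.kernel s t onePos) := by
  intro x
  have := κ.markov s t hst.le
  have : IsFiniteMeasure ((κ.kernel s t onePos).map (mulPos x)) :=
    Measure.isFiniteMeasure_map _ _
  have hx : (0 : ℝ) < x := x.2
  refine measure_pos_ext_of_put fun K hK => ?_
  have h1 : κ.put s t K x = x * κ.put s t (K / x) onePos := by
    have := hs s t hst x (K / x) 1 hx (div_pos hK hx) one_pos
    rwa [mul_div_cancel₀ _ hx.ne', mul_one] at this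
  rw [← ofReal_put hst.le, h1, ENNReal.ofReal_mul hx.le, ofReal_put hst.le,
    lintegral_map (by fun_prop) (measurable_mulPos x), ← lintegral_const_mul _ (by fun_prop)]
  refine lintegral_congr fun y => ?_
  rw [← ENNReal.ofReal_mul hx.le, coe_mulPos, mul_sub, mul_div_cancel₀ _ hx.ne']

theorem scalingProperty_of_hasRatioLaw (h : ∀ s t : I, s < t → ∃ μ, κ.HasRatioLaw s t μ) :
    κ.ScalingProperty := by
  intro s t hst α K x hα _ hx
  obtain ⟨μ, hμ⟩ := h s t hst
  exact hμ.put_mul K hα hx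

/-- Continuous returns that do not depend on the spot make vanilla options regular in the spot. -/
theorem ScalingProperty.spotRegular (hs : κ.ScalingProperty) (hκ : κ.IsMartingale)
    (hc : κ.ContinuouslyDistributed) : κ.SpotRegular := by
  have hr : ∀ s t : I, s < t → κ.HasRatioLaw s t (κ.kernel s t onePos) :=
    fun s t hst => hs.hasRatioLaw hst
  have hput : ∀ s t : I, s < t → ∀ K : ℝ,
      Set.EqOn (scaledPut (κ.kernel s t onePos) K) (κ.put s t K) (Set.Ioi 0) :=
    fun s t hst K x hx => ((hr s t hst).put_eq K hx).symm
  refine ⟨fun s t hst K _ => ?_, fun s t hst K _ => ?_, fun s t hst K hK a b ha hab => ?_,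
    fun s t hst K hK => ?_, fun s t hst K hK => ?_⟩
  all_goals have := κ.markov s t hst.le
  · exact (convexOn_scaledPut _).congr (hput s t hst K)
  · refine DifferentiableOn.congr (fun x hx => ?_) fun x hx => (hput s t hst K hx).symm
    exact (hasDerivAt_scaledPut (hc s t hst onePos) hx).differentiableAt.differentiableWithinAt
  · refine (absolutelyContinuousOnInterval_deriv_scaledPut (hc s t hst onePos) hK ha hab).congr
      fun x hx => ((hr s t hst).eqOn_deriv_put K ?_).symm
    rw [Set.uIcc_of_le hab] at hx
    exact ha.trans_le hx.1
  · refine (tendsto_scaledPut_atTop (μ := κ.kernel s t onePos) hK).congr' ?_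
    filter_upwards [eventually_gt_atTop 0] with x hx
    exact hput s t hst K hx
  · have hi := (hκ s t hst.le onePos).1
    -- The call value divided by the spot `x` is the call on the return with strike `K / x`, which
    -- tends to infinity. Dominating it by `y` is where integrability of the return enters.
    have h : Tendsto (fun x => ∫ y : Pos, max ((y : ℝ) - K / x) 0 ∂(κ.kernel s t onePos)) (𝓝[>] 0)
        (𝓝 (∫ _ : Pos, (0 : ℝ) ∂(κ.kernel s t onePos))) := by
      refine tendsto_integral_filter_of_dominated_convergence (fun y : Pos => (y : ℝ))
        (Eventually.of_forall fun x => by fun_prop) ?_ hi (Eventually.of_forall fun y => ?_)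
      · filter_upwards [self_mem_nhdsWithin] with x hx
        have hx : (0 : ℝ) < x := hx
        refine Eventually.of_forall fun y => ?_
        have hy : (0 : ℝ) < y := y.2
        have hd : 0 < K / x := div_pos hK hx
        rw [Real.norm_of_nonneg (le_max_right _ _)]
        exact max_le (by linarith) hy.le
      · refine tendsto_const_nhds.congr' ?_
        have hy : (0 : ℝ) < y := y.2
        filter_upwards [Ioo_mem_nhdsGT (div_pos hK hy)] with x hx
        have h2 := hx.2
        rw [lt_div_iff₀ hy] at h2
        have h3 : (y : ℝ) ≤ K / x := by
          rw [le_div_iff₀ hx.1]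
          linarith
        rw [max_eq_right (by linarith)]
    rw [integral_zero] at h
    refine h.congr' ?_
    filter_upwards [self_mem_nhdsWithin] with x hx
    have hx : (0 : ℝ) < x := hx
    rw [(hr s t hst).call_eq K hx, ← integral_div]
    refine integral_congr_ae (Eventually.of_forall fun y => ?_)
    simp only
    rw [← max_div_div_right hx.le, zero_div, sub_div, mul_div_cancel_left₀ _ hx.ne']

end

section

variable {𝒯 : ReversibleTimes} {κ κ' : TransitionFunction 𝒯.times}

/-- Martingale transitions, from the means of the returns. -/
theorem isMartingale_of_lintegral (h : ∀ s t : 𝒯.times, s < t → ∀ x : Pos,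
    ∫⁻ y, ENNReal.ofReal (y : ℝ) ∂(κ.kernel s t x) = ENNReal.ofReal x) : κ.IsMartingale := by
  intro s t hst x
  refine integrable_coe_of_lintegral (le_of_lt x.2) ?_
  rcases hst.lt_or_eq with hlt | rfl
  · exact h s t hlt x
  · rw [κ.refl, Kernel.id_apply, lintegral_dirac' _ (by fun_prop)]

/-- Under the scaling property, a reverse `Γ`-adjoint transition function has the dual returns. -/
theorem ScalingProperty.hasRatioLaw_reverse (hs : κ.ScalingProperty)
    (hc : κ.ContinuouslyDistributed) (h : IsReverseGammaAdjointKernel κ κ') {t t' : 𝒯.times}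
    (ht : t < t') :
    κ'.HasRatioLaw t t' (dualLaw onePos (κ.kernel (𝒯.rev t') (𝒯.rev t) onePos)) := by
  intro k
  have hlt := 𝒯.rev_lt_rev ht
  have := κ.markov _ _ hlt.le
  rw [(h t t' ht k).2, (hs.hasRatioLaw hlt).withDensity_gamma (hc _ _ hlt onePos), dualLaw_eq_map]

/-- The martingale property is not assumed here: the adjoint kernel has mass one, and that mass is
the mean of the original return. -/
theorem ScalingProperty.lintegral_coe_of_reverse (hs : κ.ScalingProperty)
    (hc : κ.ContinuouslyDistributed) (h : IsReverseGammaAdjointKernel κ κ') {t t' : 𝒯.times}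
    (ht : t < t') :
    ∫⁻ y, ENNReal.ofReal (y : ℝ) ∂(κ.kernel (𝒯.rev t') (𝒯.rev t) onePos) = 1 := by
  have := κ'.markov t t' ht.le
  rw [← dualLaw_univ onePos, ← Measure.map_id (μ := dualLaw onePos _), ← mulPos_onePos,
    ← hs.hasRatioLaw_reverse hc h ht onePos, measure_univ]

theorem ScalingProperty.scalingProperty_reverse (hs : κ.ScalingProperty)
    (hc : κ.ContinuouslyDistributed) (h : IsReverseGammaAdjointKernel κ κ') :
    κ'.ScalingProperty :=
  scalingProperty_of_hasRatioLaw fun _ _ ht => ⟨_, hs.hasRatioLaw_reverse hc h ht⟩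

/-- Under put-call symmetry, the dual returns have the same law as the returns. -/
theorem PutCallSymmetry.dualLaw_eq (hp : κ.PutCallSymmetry) {s t : 𝒯.times} (hst : s < t)
    {μ : Measure Pos} [IsProbabilityMeasure μ] (hr : κ.HasRatioLaw s t μ)
    (h1 : ∫⁻ y, ENNReal.ofReal (y : ℝ) ∂μ = 1) : dualLaw onePos μ = μ := by
  have : IsFiniteMeasure (dualLaw onePos μ) :=
    ⟨by rw [dualLaw_univ, h1]; exact ENNReal.one_lt_top⟩
  have hi : Integrable (fun y : Pos => (y : ℝ)) μ :=
    (integrable_coe_of_lintegral zero_le_one (by rw [h1, ENNReal.ofReal_one])).1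
  refine measure_pos_ext_of_put fun K hK => ?_
  -- At spot `1` the strikes `1 / K` and `K` are symmetric, giving `K C(1 / K | 1) = P(K | 1)`. The
  -- left side is the put price under the dual law, since `y (K - 1 / y)⁺ = K (y - 1 / K)⁺`.
  have hpc := hp s t hst 1 K⁻¹ K one_pos (inv_pos.2 hK) hK (by field_simp)
  have hcall : κ.call s t K⁻¹ 1 * K = κ.put s t K 1 := by
    have hsq : √K * √K = K := Real.mul_self_sqrt hK.le
    have hpos : 0 < √K := Real.sqrt_pos.2 hK
    rw [Real.sqrt_inv, div_inv_eq_mul, eq_div_iff hpos.ne', mul_assoc, hsq] at hpc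
    exact hpc
  rw [lintegral_dualLaw _ _ (by fun_prop), ← ofReal_integral_put_payoff]
  have hput : ∫ y, max (K - (y : ℝ)) 0 ∂μ = κ.put s t K 1 := by
    rw [hr.put_eq K one_pos]
    simp only [scaledPut, one_mul]
  have hint : Integrable (fun y : Pos => max (1 * (y : ℝ) - K⁻¹) 0 * K) μ := by
    simp only [one_mul]
    exact ((hi.sub (integrable_const K⁻¹)).pos_part).mul_const K
  rw [hput, ← hcall, hr.call_eq _ one_pos, ← integral_mul_const,
    ofReal_integral_eq_lintegral_ofReal hint (Eventually.of_forall fun y =>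
      mul_nonneg (le_max_right _ _) hK.le)]
  refine lintegral_congr fun y => ?_
  have hy : (0 : ℝ) < y := y.2
  rw [← ENNReal.ofReal_mul hy.le, coe_divPos, max_mul_of_nonneg _ _ hK.le, zero_mul,
    ENNReal.ofReal_max, ENNReal.ofReal_zero, max_eq_left zero_le]
  congr 1
  change (y : ℝ) * (K - 1 / y) = _
  field_simp

end

end TransitionFunction

/-! ### Markov processes: integrated transitions, returns and martingales -/

namespace IsMarkovProcess

section

variable {I : Type*} [Preorder I] {κ : TransitionFunction I} {Ω : Type*} [mΩ : MeasurableSpace Ω]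
  {X : I → Ω → Pos} {ℱ : Filtration I mΩ} {Q : Measure Ω} {s t : I}

theorem measurable (h : IsMarkovProcess κ X ℱ Q) (t : I) : Measurable (X t) :=
  (h.adapted t).mono (ℱ.le t) le_rfl

variable [IsProbabilityMeasure Q]

theorem measure_inter (h : IsMarkovProcess κ X ℱ Q) (hst : s ≤ t) {A : Set Ω}
    (hA : MeasurableSet[ℱ s] A) {B : Set Pos} (hB : MeasurableSet B) :
    Q (A ∩ X t ⁻¹' B) = ∫⁻ ω in A, κ.kernel s t (X s ω) B ∂Q := by
  have := κ.markov s t hst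
  have hBt : MeasurableSet (X t ⁻¹' B) := h.measurable t hB
  have hint : Integrable ((X t ⁻¹' B).indicator fun _ => (1 : ℝ)) Q :=
    (integrable_const 1).indicator hBt
  have h1 := setIntegral_condExp (ℱ.le s) hint hA
  rw [setIntegral_congr_ae (ℱ.le s A hA) ((h.transition s t hst B hB).mono fun _ hω _ => hω),
    integral_indicator hBt, Measure.restrict_restrict hBt, setIntegral_const, smul_eq_mul, mul_one,
    Set.inter_comm] at h1
  have hk : Measurable fun ω => κ.kernel s t (X s ω) B :=
    (Kernel.measurable_coe _ hB).comp (h.measurable s)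
  rw [← ofReal_measureReal, ← h1, ofReal_integral_eq_lintegral_ofReal]
  · refine lintegral_congr fun ω => ?_
    rw [ofReal_measureReal]
  · refine Integrable.of_bound hk.ennreal_toReal.aestronglyMeasurable 1
      (Eventually.of_forall fun ω => ?_)
    rw [Real.norm_of_nonneg measureReal_nonneg]
    exact measureReal_le_one
  · exact Eventually.of_forall fun ω => measureReal_nonneg

/-- A process is Markov as soon as its transitions have the right weights on a `π`-system that
generates the information at each time. -/
theorem of_measure_inter (hX : ∀ t : I, Measurable[ℱ t] (X t))
    (h : ∀ s t : I, s ≤ t → ∃ C : Set (Set Ω), ℱ s = MeasurableSpace.generateFrom C ∧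
      IsPiSystem C ∧ ∀ A ∈ C ∪ {Set.univ}, ∀ B : Set Pos, MeasurableSet B →
        Q (A ∩ X t ⁻¹' B) = ∫⁻ ω in A, κ.kernel s t (X s ω) B ∂Q) :
    IsMarkovProcess κ X ℱ Q where
  adapted := hX
  transition s t hst B hB := by
    have := κ.markov s t hst
    obtain ⟨C, hgen, hpi, hC⟩ := h s t hst
    have hXm : ∀ t : I, Measurable (X t) := fun t => (hX t).mono (ℱ.le t) le_rfl
    have hBt : MeasurableSet (X t ⁻¹' B) := hXm t hB
    have hint : Integrable ((X t ⁻¹' B).indicator fun _ => (1 : ℝ)) Q :=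
      (integrable_const 1).indicator hBt
    have hks : Measurable[ℱ s] fun ω => κ.kernel s t (X s ω) B :=
      (Kernel.measurable_coe _ hB).comp (hX s)
    have hk : Measurable fun ω => κ.kernel s t (X s ω) B := hks.mono (ℱ.le s) le_rfl
    have hki : Integrable (fun ω => (κ.kernel s t (X s ω)).real B) Q := by
      refine Integrable.of_bound hk.ennreal_toReal.aestronglyMeasurable 1
        (Eventually.of_forall fun ω => ?_)
      rw [Real.norm_of_nonneg measureReal_nonneg]
      exact measureReal_le_one
    have hall : ∀ A, MeasurableSet[ℱ s] A →
        Q (A ∩ X t ⁻¹' B) = ∫⁻ ω in A, κ.kernel s t (X s ω) B ∂Q := by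
      have hsub : ∀ A ∈ C, MeasurableSet A := fun A hA => by
        refine ℱ.le s A ?_
        rw [hgen]
        exact MeasurableSpace.measurableSet_generateFrom hA
      -- Both sides of the claim are finite measures in `A` on `ℱ s`, so agreement on the generating
      -- `π`-system and on the whole space suffices.
      have heq : (Q.restrict (X t ⁻¹' B)).trim (ℱ.le s)
          = (Q.withDensity fun ω => κ.kernel s t (X s ω) B).trim (ℱ.le s) := by
        have hfin : IsFiniteMeasure ((Q.restrict (X t ⁻¹' B)).trim (ℱ.le s)) :=
          isFiniteMeasure_trim _
        refine ext_of_generate_finite C hgen hpi (fun A hA => ?_) ?_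
        · have hAs : MeasurableSet[ℱ s] A := by
            rw [hgen]
            exact MeasurableSpace.measurableSet_generateFrom hA
          rw [trim_measurableSet_eq _ hAs, trim_measurableSet_eq _ hAs,
            Measure.restrict_apply (hsub A hA), withDensity_apply _ (hsub A hA),
            hC A (Or.inl hA) B hB]
        · rw [trim_measurableSet_eq _ MeasurableSet.univ, trim_measurableSet_eq _ MeasurableSet.univ,
            Measure.restrict_apply MeasurableSet.univ, withDensity_apply _ MeasurableSet.univ,
            hC Set.univ (Or.inr rfl) B hB]
      intro A hA
      have := congrArg (fun m : @Measure Ω (ℱ s) => m A) heq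
      rwa [trim_measurableSet_eq _ hA, trim_measurableSet_eq _ hA,
        Measure.restrict_apply (ℱ.le s A hA), withDensity_apply _ (ℱ.le s A hA)] at this
    refine (ae_eq_condExp_of_forall_setIntegral_eq (ℱ.le s) hint
      (fun A _ _ => hki.integrableOn) (fun A hA _ => ?_)
      hks.ennreal_toReal.stronglyMeasurable.aestronglyMeasurable).symm
    rw [integral_indicator hBt, Measure.restrict_restrict hBt, setIntegral_const, smul_eq_mul,
      mul_one, Set.inter_comm, measureReal_def, hall A hA]
    exact integral_toReal hk.aemeasurable (Eventually.of_forall fun ω => measure_lt_top _ _)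

theorem map_restrict (h : IsMarkovProcess κ X ℱ Q) (hst : s ≤ t) {A : Set Ω}
    (hA : MeasurableSet[ℱ s] A) :
    (Q.restrict A).map (X t) = ((Q.restrict A).map (X s)).bind (κ.kernel s t) := by
  ext B hB
  rw [Measure.map_apply (h.measurable t) hB, Measure.restrict_apply (h.measurable t hB),
    Measure.bind_apply hB (Kernel.aemeasurable _), lintegral_map (Kernel.measurable_coe _ hB)
    (h.measurable s), Set.inter_comm, h.measure_inter hst hA hB]

theorem setLIntegral_comp (h : IsMarkovProcess κ X ℱ Q) (hst : s ≤ t) {A : Set Ω}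
    (hA : MeasurableSet[ℱ s] A) {g : Pos → ℝ≥0∞} (hg : Measurable g) :
    ∫⁻ ω in A, g (X t ω) ∂Q = ∫⁻ ω in A, ∫⁻ y, g y ∂(κ.kernel s t (X s ω)) ∂Q := by
  rw [← lintegral_map hg (h.measurable t), h.map_restrict hst hA,
    Measure.lintegral_bind (Kernel.aemeasurable _) hg.aemeasurable,
    lintegral_map hg.lintegral_kernel (h.measurable s)]

theorem map_prod (h : IsMarkovProcess κ X ℱ Q) (hst : s ≤ t) :
    Q.map (fun ω => (X s ω, X t ω)) = (Q.map (X s)) ⊗ₘ (κ.kernel s t) := by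
  have := κ.markov s t hst
  have hm : Measurable fun ω => (X s ω, X t ω) := (h.measurable s).prodMk (h.measurable t)
  have hp : IsFiniteMeasure (Q.map fun ω => (X s ω, X t ω)) := Measure.isFiniteMeasure_map _ _
  have hp2 : IsFiniteMeasure (Q.map (X s)) := Measure.isFiniteMeasure_map _ _
  refine Measure.ext_prod fun {C B} hC hB => ?_
  rw [Measure.map_apply hm (hC.prod hB), Measure.compProd_apply_prod hC hB,
    setLIntegral_map hC (Kernel.measurable_coe _ hB) (h.measurable s),
    ← h.measure_inter hst (h.adapted s hC) hB]
  rfl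

/-- If the returns of the transition function do not depend on the spot, then the return of the
process has the same law. -/
theorem map_ratio (h : IsMarkovProcess κ X ℱ Q) (hst : s ≤ t) {μ : Measure Pos}
    (hr : κ.HasRatioLaw s t μ) : Q.map (fun ω => divPos (X t ω) (X s ω)) = μ := by
  have := κ.markov s t hst
  have hm : Measurable fun ω => (X s ω, X t ω) := (h.measurable s).prodMk (h.measurable t)
  have hp2 : IsProbabilityMeasure (Q.map (X s)) :=
    Measure.isProbabilityMeasure_map (h.measurable s).aemeasurable
  have h1 : Q.map (fun ω => divPos (X t ω) (X s ω))
      = (Q.map fun ω => (X s ω, X t ω)).map (fun p : Pos × Pos => divPos p.2 p.1) := by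
    rw [Measure.map_map measurable_divPos_prod hm]
    rfl
  rw [h1, h.map_prod hst]
  ext B hB
  rw [Measure.map_apply measurable_divPos_prod hB,
    Measure.compProd_apply (measurable_divPos_prod hB)]
  have h2 : ∀ x : Pos, κ.kernel s t x (Prod.mk x ⁻¹' ((fun p : Pos × Pos => divPos p.2 p.1) ⁻¹' B))
      = μ B := by
    intro x
    rw [hr x, Measure.map_apply (measurable_mulPos x)
      (measurable_prodMk_left (measurable_divPos_prod hB))]
    congr 1
    ext y
    simp only [Set.mem_preimage, divPos_mulPos_cancel]
  simp_rw [h2]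
  rw [lintegral_const, measure_univ, mul_one]

/-- A Markov process with martingale transitions and integrable initial value is a martingale. -/
theorem martingale (h : IsMarkovProcess κ X ℱ Q) (hκ : κ.IsMartingale) {t₀ : I}
    (ht₀ : ∀ t, t₀ ≤ t) (h0 : Integrable (fun ω => (X t₀ ω : ℝ)) Q) :
    Martingale (fun t ω => (X t ω : ℝ)) ℱ Q := by
  have hpos : ∀ t, 0 ≤ᵐ[Q] fun ω => (X t ω : ℝ) :=
    fun t => Eventually.of_forall fun ω => le_of_lt (X t ω).2
  have hmeas : ∀ t, Measurable fun ω => (X t ω : ℝ) :=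
    fun t => measurable_subtype_coe.comp (h.measurable t)
  -- Positivity permits comparing expectations in `[0, ∞]` before integrability is known; taking `A
  -- = univ` then carries integrability from `t₀` to all later times.
  have hset : ∀ s t, s ≤ t → ∀ A, MeasurableSet[ℱ s] A →
      ∫⁻ ω in A, ENNReal.ofReal (X t ω) ∂Q = ∫⁻ ω in A, ENNReal.ofReal (X s ω) ∂Q := by
    intro s t hst A hA
    rw [h.setLIntegral_comp hst hA (g := fun y : Pos => ENNReal.ofReal (y : ℝ)) (by fun_prop)]
    refine lintegral_congr fun ω => ?_
    rw [lintegral_coe_of_integrable (hκ s t hst _).1, (hκ s t hst _).2]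
  have hint : ∀ t, Integrable (fun ω => (X t ω : ℝ)) Q := by
    intro t
    refine ⟨(hmeas t).aestronglyMeasurable, (hasFiniteIntegral_iff_ofReal (hpos t)).2 ?_⟩
    have := hset t₀ t (ht₀ t) Set.univ MeasurableSet.univ
    rw [setLIntegral_univ, setLIntegral_univ] at this
    rw [this]
    exact (hasFiniteIntegral_iff_ofReal (hpos t₀)).1 h0.2
  refine ⟨fun t => (measurable_subtype_coe.comp (h.adapted t)).stronglyMeasurable,
    fun s t hst => ?_⟩
  refine (ae_eq_condExp_of_forall_setIntegral_eq (ℱ.le s) (hint t)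
    (fun A _ _ => (hint s).integrableOn) (fun A hA _ => ?_)
    (measurable_subtype_coe.comp (h.adapted s)).stronglyMeasurable.aestronglyMeasurable).symm
  rw [integral_eq_lintegral_of_nonneg_ae (ae_restrict_of_ae (hpos s))
    (hmeas s).aestronglyMeasurable, integral_eq_lintegral_of_nonneg_ae
    (ae_restrict_of_ae (hpos t)) (hmeas t).aestronglyMeasurable, hset s t hst A hA]

end

/-- Under the scaling property, a Markov process can only be a martingale if its transition function
is one. -/
theorem isMartingale_transition {𝒯 : ReversibleTimes} {κ : TransitionFunction 𝒯.times} {Ω : Type*}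
    [mΩ : MeasurableSpace Ω] {X : 𝒯.times → Ω → Pos} {ℱ : Filtration 𝒯.times mΩ} {Q : Measure Ω}
    [IsProbabilityMeasure Q] (h : IsMarkovProcess κ X ℱ Q) (hs : κ.ScalingProperty)
    (hM : Martingale (fun t ω => (X t ω : ℝ)) ℱ Q) : κ.IsMartingale := by
  refine TransitionFunction.isMartingale_of_lintegral fun s t hst x => ?_
  have hr := hs.hasRatioLaw hst
  have hpos : ∀ t, 0 ≤ᵐ[Q] fun ω => (X t ω : ℝ) :=
    fun t => Eventually.of_forall fun ω => le_of_lt (X t ω).2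
  have hms : Measurable fun ω => ENNReal.ofReal (X s ω : ℝ) :=
    ENNReal.measurable_ofReal.comp (measurable_subtype_coe.comp (h.measurable s))
  have h1 : ∫⁻ ω, ENNReal.ofReal (X t ω) ∂Q = ∫⁻ ω, ENNReal.ofReal (X s ω) ∂Q := by
    rw [← ofReal_integral_eq_lintegral_ofReal (hM.integrable t) (hpos t),
      ← ofReal_integral_eq_lintegral_ofReal (hM.integrable s) (hpos s)]
    have := hM.setIntegral_eq hst.le MeasurableSet.univ
    rw [setIntegral_univ, setIntegral_univ] at this
    rw [this]
  -- The expectation at `t` is that at `s` times the mean return. The expectation at `s` is finite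
  -- and positive and equals that at `t`, so it cancels and the mean return is one.
  have h2 : ∫⁻ ω, ENNReal.ofReal (X t ω) ∂Q = (∫⁻ ω, ENNReal.ofReal (X s ω) ∂Q) *
      ∫⁻ y, ENNReal.ofReal (y : ℝ) ∂(κ.kernel s t onePos) := by
    have h3 := h.setLIntegral_comp hst.le MeasurableSet.univ
      (g := fun y : Pos => ENNReal.ofReal (y : ℝ)) (by fun_prop)
    rw [setLIntegral_univ, setLIntegral_univ] at h3
    rw [h3, ← lintegral_mul_const _ hms]
    exact lintegral_congr fun ω => hr.lintegral_coe _
  have hfin : ∫⁻ ω, ENNReal.ofReal (X s ω) ∂Q ≠ ∞ :=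
    ((hasFiniteIntegral_iff_ofReal (hpos s)).1 (hM.integrable s).2).ne
  have hne : ∫⁻ ω, ENNReal.ofReal (X s ω) ∂Q ≠ 0 := by
    intro h0
    rw [lintegral_eq_zero_iff hms] at h0
    obtain ⟨ω, hω⟩ := h0.exists
    exact (ENNReal.ofReal_pos.2 (X s ω).2).ne' hω
  rw [h1] at h2
  have h4 : ∫⁻ y, ENNReal.ofReal (y : ℝ) ∂(κ.kernel s t onePos) = 1 :=
    (ENNReal.mul_right_inj hne hfin).1 (by rw [mul_one, ← h2])
  rw [hr.lintegral_coe, h4, mul_one]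

end IsMarkovProcess

/-! ### Densities of log-returns -/

section LogReturns

variable {μ : Measure Pos}

theorem measurable_log_coe : Measurable fun y : Pos => Real.log (y : ℝ) := by fun_prop

theorem absolutelyContinuous_map_log (hμ : μ ≪ (volume : Measure Pos)) :
    μ.map (fun y : Pos => Real.log (y : ℝ)) ≪ (volume : Measure ℝ) := by
  refine Measure.AbsolutelyContinuous.mk fun N hN hN0 => ?_
  rw [Measure.map_apply measurable_log_coe hN]
  exact measure_eq_zero_of_leftInvOn hμ (f := Real.log) (g := Real.exp)
    (fun y hy => Real.exp_log hy) Real.differentiable_exp.differentiableOn hN0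

/-- The density of the logarithm of the dual return. -/
theorem map_log_dualLaw [IsFiniteMeasure μ] (hμ : μ ≪ (volume : Measure Pos)) :
    (dualLaw onePos μ).map (fun y : Pos => Real.log (y : ℝ))
      = (volume : Measure ℝ).withDensity fun ξ => ENNReal.ofReal (Real.exp (-ξ)) *
          (μ.map fun y : Pos => Real.log (y : ℝ)).rnDeriv volume (-ξ) := by
  set L := μ.map fun y : Pos => Real.log (y : ℝ) with hL
  have hLd : volume.withDensity (L.rnDeriv volume) = L :=
    Measure.withDensity_rnDeriv_eq _ _ (absolutelyContinuous_map_log hμ)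
  refine Measure.ext_of_lintegral _ fun g hg => ?_
  have hd : Measurable fun ξ : ℝ => ENNReal.ofReal (Real.exp (-ξ)) * L.rnDeriv volume (-ξ) :=
    (by fun_prop : Measurable fun ξ : ℝ => ENNReal.ofReal (Real.exp (-ξ))).mul
      ((Measure.measurable_rnDeriv _ _).comp measurable_neg)
  have hg' : Measurable fun ξ : ℝ => ENNReal.ofReal (Real.exp ξ) * g (-ξ) :=
    (by fun_prop : Measurable fun ξ : ℝ => ENNReal.ofReal (Real.exp ξ)).mul
      (hg.comp measurable_neg)
  rw [lintegral_map hg measurable_log_coe, lintegral_dualLaw _ _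
      (g := fun y => g (Real.log (y : ℝ))) (hg.comp measurable_log_coe),
    lintegral_withDensity_eq_lintegral_mul _ hd hg]
  have h1 : ∀ y : Pos, ENNReal.ofReal (y : ℝ) * g (Real.log (divPos onePos y : ℝ))
      = ENNReal.ofReal (Real.exp (Real.log (y : ℝ))) * g (-Real.log (y : ℝ)) := by
    intro y
    rw [Real.exp_log y.2, coe_divPos]
    congr 2
    exact (congrArg Real.log (one_div (y : ℝ))).trans (Real.log_inv (y : ℝ))
  simp_rw [h1]
  -- In the variable `ξ = log y` the weight `y` is `e^ξ` and inversion is `ξ ↦ -ξ`; reflecting the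
  -- Lebesgue integral turns the weight into `e^{-ξ}`.
  rw [← lintegral_map (f := fun ξ : ℝ => ENNReal.ofReal (Real.exp ξ) * g (-ξ)) hg'
    measurable_log_coe, ← hL, ← hLd,
    lintegral_withDensity_eq_lintegral_mul _ (Measure.measurable_rnDeriv _ _) hg', hLd,
    ← lintegral_neg_eq_self]
  refine lintegral_congr fun ξ => ?_
  simp only [Pi.mul_apply, neg_neg]
  ring

/-- If a positive ratio has the continuous law `μ`, then its logarithm has a density. -/
theorem hasPDF_log_of_map_eq {Ω : Type*} [MeasurableSpace Ω] {Q : Measure Ω} {R : Ω → Pos}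
    [IsFiniteMeasure Q] (hR : Measurable R) (hμ : Q.map R ≪ (volume : Measure Pos)) :
    HasPDF (fun ω => Real.log (R ω : ℝ)) Q volume := by
  have hm : Measurable fun ω => Real.log (R ω : ℝ) := measurable_log_coe.comp hR
  have hfin : IsFiniteMeasure (Q.map fun ω => Real.log (R ω : ℝ)) := Measure.isFiniteMeasure_map _ _
  refine hasPDF_iff.2 ⟨hm.aemeasurable, inferInstance, ?_⟩
  have := absolutelyContinuous_map_log hμ
  rwa [Measure.map_map measurable_log_coe hR] at this

theorem absolutelyContinuous_dualLaw (hμ : μ ≪ (volume : Measure Pos)) (k : Pos) :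
    dualLaw k μ ≪ (volume : Measure Pos) := by
  refine Measure.AbsolutelyContinuous.mk fun N hN hN0 => ?_
  have h1 : volume (Subtype.val '' N : Set ℝ) = 0 := by
    rw [← (MeasurableEmbedding.subtype_coe measurableSet_Ioi).comap_apply]
    exact hN0
  have h2 := absolutelyContinuous_map_dualLaw hμ k h1
  rwa [Measure.map_apply measurable_subtype_coe
    ((MeasurableEmbedding.subtype_coe measurableSet_Ioi).measurableSet_image.2 hN),
    Set.preimage_image_eq _ Subtype.val_injective] at h2

end LogReturns

/-! ### The Black–Scholes process is its own adjoint -/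

section BlackScholes

/-- The exponential function, with values in the positive prices. -/
noncomputable def expPos (z : ℝ) : Pos := ⟨Real.exp z, Set.mem_Ioi.2 (Real.exp_pos z)⟩

theorem measurable_expPos : Measurable expPos := Measurable.subtype_mk (by fun_prop)

/-- The law of the Black–Scholes return over a time step of length `d`. -/
noncomputable def bsLaw (σ d : ℝ) : Measure Pos :=
  (gaussianReal (-(σ ^ 2 * d / 2)) (σ ^ 2 * d).toNNReal).map expPos

theorem bsStep_eq_map (σ d : ℝ) (x : Pos) : bsStep σ d x = (bsLaw σ d).map (mulPos x) := by
  ext B hB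
  rw [bsStep_apply' σ d x hB, bsLaw, Measure.map_apply (measurable_mulPos x) hB,
    Measure.map_apply measurable_expPos (measurable_mulPos x hB)]
  rfl

instance isProbabilityMeasure_bsLaw (σ d : ℝ) : IsProbabilityMeasure (bsLaw σ d) :=
  Measure.isProbabilityMeasure_map measurable_expPos.aemeasurable

theorem absolutelyContinuous_bsLaw {σ d : ℝ} (hσ : 0 < σ) (hd : 0 < d) :
    bsLaw σ d ≪ (volume : Measure Pos) := by
  have hv : (σ ^ 2 * d).toNNReal ≠ 0 := (Real.toNNReal_pos.2 (by positivity)).ne'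
  refine Measure.AbsolutelyContinuous.mk fun N hN hN0 => ?_
  have h1 : volume (Subtype.val '' N : Set ℝ) = 0 := by
    rw [← (MeasurableEmbedding.subtype_coe measurableSet_Ioi).comap_apply]
    exact hN0
  have h2 : volume (Real.log '' (Subtype.val '' N : Set ℝ)) = 0 := by
    refine addHaar_image_eq_zero_of_differentiableOn_of_addHaar_eq_zero volume ?_ h1
    rintro _ ⟨y, -, rfl⟩
    exact (Real.differentiableAt_log (ne_of_gt y.2)).differentiableWithinAt
  rw [bsLaw, Measure.map_apply measurable_expPos hN]
  refine gaussianReal_absolutelyContinuous _ hv (measure_mono_null (fun z hz => ?_) h2)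
  exact ⟨Real.exp z, ⟨expPos z, hz, rfl⟩, Real.log_exp z⟩

/-- The squares `(z + v / 2)²` and `(z - v / 2)²` differ by `2 v z`, which the factor `1 / (2 v)`
turns into `z`. The martingale drift `-v / 2` is exactly what makes this work. -/
theorem gaussianPDF_neg_eq {v : ℝ≥0} (hv : v ≠ 0) (z : ℝ) :
    gaussianPDF (-((v : ℝ) / 2)) v (-z)
      = ENNReal.ofReal (Real.exp z) * gaussianPDF (-((v : ℝ) / 2)) v z := by
  rw [gaussianPDF, gaussianPDF, ← ENNReal.ofReal_mul (Real.exp_pos z).le, gaussianPDFReal,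
    gaussianPDFReal]
  congr 1
  have hv' : (v : ℝ) ≠ 0 := by exact_mod_cast hv
  rw [mul_left_comm, ← Real.exp_add]
  congr 2
  field_simp
  ring

/-- The Black–Scholes transition law is its own dual. -/
theorem dualLaw_bsLaw {σ d : ℝ} (hσ : 0 < σ) (hd : 0 < d) (k : Pos) :
    dualLaw k (bsLaw σ d) = bsStep σ d k := by
  have hpos : 0 < σ ^ 2 * d := by positivity
  have hv : (σ ^ 2 * d).toNNReal ≠ 0 := (Real.toNNReal_pos.2 hpos).ne'
  have hm : -(σ ^ 2 * d / 2) = -(((σ ^ 2 * d).toNNReal : ℝ) / 2) := by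
    rw [Real.coe_toNNReal _ hpos.le]
  rw [bsStep_eq_map]
  refine Measure.ext_of_lintegral _ fun g hg => ?_
  have hg1 : Measurable fun z : ℝ => g (mulPos k (expPos z)) :=
    hg.comp ((measurable_mulPos k).comp measurable_expPos)
  have hg2 : Measurable fun z : ℝ => ENNReal.ofReal (expPos z : ℝ) * g (divPos k (expPos z)) :=
    (ENNReal.measurable_ofReal.comp (measurable_subtype_coe.comp measurable_expPos)).mul
      (hg.comp ((measurable_divPos k).comp measurable_expPos))
  rw [lintegral_dualLaw k _ hg, lintegral_map hg (measurable_mulPos k), bsLaw,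
    lintegral_map (f := fun y => g (mulPos k y)) (hg.comp (measurable_mulPos k)) measurable_expPos,
    lintegral_map (f := fun y : Pos => ENNReal.ofReal (y : ℝ) * g (divPos k y)) ((by fun_prop : Measurable fun y : Pos => ENNReal.ofReal (y : ℝ)).mul
      (hg.comp (measurable_divPos k))) measurable_expPos,
    hm, gaussianReal_of_var_ne_zero _ hv,
    lintegral_withDensity_eq_lintegral_mul _ (measurable_gaussianPDF _ _) hg1,
    lintegral_withDensity_eq_lintegral_mul _ (measurable_gaussianPDF _ _) hg2,
    ← lintegral_neg_eq_self]
  refine lintegral_congr fun z => ?_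
  have hdiv : divPos k (expPos (-z)) = mulPos k (expPos z) := by
    refine Subtype.ext ?_
    change (k : ℝ) / Real.exp (-z) = k * Real.exp z
    rw [Real.exp_neg, div_inv_eq_mul]
  simp only [Pi.mul_apply]
  rw [hdiv, gaussianPDF_neg_eq hv]
  have : ENNReal.ofReal (Real.exp z) * ENNReal.ofReal (expPos (-z) : ℝ) = 1 := by
    rw [← ENNReal.ofReal_mul (Real.exp_pos z).le]
    change ENNReal.ofReal (Real.exp z * Real.exp (-z)) = 1
    rw [← Real.exp_add, add_neg_cancel, Real.exp_zero, ENNReal.ofReal_one]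
  calc _ = (ENNReal.ofReal (Real.exp z) * ENNReal.ofReal (expPos (-z) : ℝ)) *
        (gaussianPDF (-(((σ ^ 2 * d).toNNReal : ℝ) / 2)) (σ ^ 2 * d).toNNReal z *
          g (mulPos k (expPos z))) := by ring
    _ = _ := by rw [this, one_mul]

theorem isReverseGammaAdjointKernel_bsTransition (𝒯 : ReversibleTimes) {σ : ℝ} (hσ : 0 < σ) :
    IsReverseGammaAdjointKernel (bsTransition 𝒯 σ) (bsTransition 𝒯 σ) := by
  intro t t' h k
  have hd : 0 < (t' : ℝ) - t := sub_pos.2 (Subtype.coe_lt_coe.2 h)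
  have hrev : (𝒯.rev t : ℝ) - 𝒯.rev t' = t' - t := sub_sub_sub_cancel_left _ _ _
  have hac := absolutelyContinuous_bsLaw hσ hd
  have hr : (bsTransition 𝒯 σ).HasRatioLaw (𝒯.rev t') (𝒯.rev t) (bsLaw σ ((t' : ℝ) - t)) := by
    intro x
    rw [← bsStep_eq_map, ← hrev]
    rfl
  refine ⟨Eventually.of_forall fun k' => ?_, ?_⟩
  · rw [hr.gamma_eq k k'.2]
    exact (convexOn_scaledPut _).deriv_deriv_nonneg (fun x hx =>
      (hasDerivAt_scaledPut hac hx).differentiableAt.differentiableWithinAt) k'.2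
  · rw [hr.withDensity_gamma hac, dualLaw_bsLaw hσ hd]
    rfl

/-- The later price is the current one times a function of one Brownian increment, which is
independent of the Brownian past. Integrating out the increment leaves the transition kernel. -/
theorem isMarkovProcess_bsProcess (𝒯 : ReversibleTimes) (σ : ℝ) (S₀ : Pos) {Ω : Type*}
    [MeasurableSpace Ω] {Q : Measure Ω} [IsProbabilityMeasure Q] {W : ℝ≥0 → Ω → ℝ}
    (hW : ∀ t, Measurable (W t)) (hB : IsPreBrownianReal W Q) :
    IsMarkovProcess (bsTransition 𝒯 σ) (bsProcess 𝒯 σ S₀ W)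
      (Filtration.natural (bsProcess 𝒯 σ S₀ W) (stronglyMeasurable_bsProcess 𝒯 σ S₀ hW)) Q := by
  set ℱ := Filtration.natural (bsProcess 𝒯 σ S₀ W) (stronglyMeasurable_bsProcess 𝒯 σ S₀ hW)
  refine IsMarkovProcess.of_measure_inter
    (fun t => measurable_iff_comap_le.2 (le_iSup₂_of_le t le_rfl le_rfl))
    fun s t hst => ⟨{A | MeasurableSet[ℱ s] A},
      (@MeasurableSpace.generateFrom_measurableSet _ (ℱ s)).symm,
      @MeasurableSpace.isPiSystem_measurableSet _ (ℱ s), fun A hA B hBm => ?_⟩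
  have hA : MeasurableSet[ℱ s] A := by
    rcases hA with hA | rfl
    · exact hA
    · exact MeasurableSet.univ
  set s' : ℝ≥0 := ⟨s, (𝒯.subset_Icc s.2).1⟩ with hs'
  set d : ℝ≥0 := ⟨(t : ℝ) - s, sub_nonneg.2 hst⟩ with hd
  have hsd : (⟨t, (𝒯.subset_Icc t.2).1⟩ : ℝ≥0) = s' + d :=
    Subtype.ext (add_sub_cancel (s : ℝ) (t : ℝ)).symm
  let past : Ω → Set.Iic s' → ℝ := fun ω u => W u ω
  let incr : Ω → ℝ := fun ω => W (s' + d) ω - W s' ω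
  have hpast : Measurable past := measurable_pi_lambda _ fun u => hW u
  have hincr : Measurable incr := (hW _).sub (hW _)
  have hind : IndepFun past incr Q := by
    have hd : Measurable fun f : ℝ≥0 → ℝ => f d := measurable_pi_apply d
    exact ((hB.indepFun_shift s').comp hd measurable_id).symm
  -- The price filtration is contained in the information of the Brownian past, so every event in it
  -- is of the form `past ⁻¹' A'`.
  have hle : ℱ s ≤ MeasurableSpace.comap past inferInstance := by
    refine iSup₂_le fun u hu => ?_
    rw [← measurable_iff_comap_le]
    have hWu : Measurable[MeasurableSpace.comap past inferInstance]
        (W ⟨u, (𝒯.subset_Icc u.2).1⟩) :=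
      (measurable_pi_apply (⟨⟨u, (𝒯.subset_Icc u.2).1⟩, hu⟩ : Set.Iic s')).comp
        (comap_measurable past)
    refine Measurable.subtype_mk ?_
    exact ((((hWu.const_mul σ).sub_const _).exp)).const_mul _
  obtain ⟨A', hA', rfl⟩ := hle A hA
  let start : (Set.Iic s' → ℝ) → Pos := fun f =>
    ⟨(S₀ : ℝ) * Real.exp (σ * f ⟨s', Set.mem_Iic.2 le_rfl⟩ - σ ^ 2 * s / 2),
      Set.mem_Ioi.2 (mul_pos S₀.2 (Real.exp_pos _))⟩
  have hstart : Measurable start := Measurable.subtype_mk (by fun_prop)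
  have hS : ∀ ω, bsProcess 𝒯 σ S₀ W s ω = start (past ω) := fun ω => rfl
  let drift : ℝ → ℝ := fun z => σ * z - σ ^ 2 * d / 2
  have hdrift : Measurable drift := by fun_prop
  have hT : ∀ ω, bsProcess 𝒯 σ S₀ W t ω = mulPos (start (past ω)) (expPos (drift (incr ω))) := by
    intro ω
    refine Subtype.ext ?_
    change (S₀ : ℝ) * Real.exp (σ * W ⟨t, (𝒯.subset_Icc t.2).1⟩ ω - σ ^ 2 * t / 2) =
      (S₀ : ℝ) * Real.exp (σ * W s' ω - σ ^ 2 * s / 2) *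
        Real.exp (σ * (W (s' + d) ω - W s' ω) - σ ^ 2 * ((t : ℝ) - s) / 2)
    rw [hsd, mul_assoc, ← Real.exp_add]
    congr 2
    ring
  have hlaw : Q.map incr = gaussianReal 0 d := by
    have := (hB.hasLaw_sub (s' + d) s').map_eq
    rwa [show nndist (s' + d : ℝ≥0).1 (s' : ℝ≥0).1 = d from ?_] at this
    refine NNReal.coe_injective ?_
    rw [coe_nndist, Real.dist_eq]
    have : ((s' + d : ℝ≥0) : ℝ) - (s' : ℝ) = d := by push_cast; ring
    exact (congrArg abs this).trans (abs_of_nonneg d.2)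
  have hstep : (Q.map incr).map (fun z => expPos (drift z)) = bsLaw σ ((t : ℝ) - s) := by
    rw [hlaw, bsLaw, show (fun z => expPos (drift z)) = expPos ∘ drift from rfl,
      ← Measure.map_map measurable_expPos hdrift]
    congr 1
    rw [show drift = (fun z => z - σ ^ 2 * d / 2) ∘ fun z => σ * z from rfl,
      ← Measure.map_map (by fun_prop) (by fun_prop), gaussianReal_map_const_mul,
      gaussianReal_map_sub_const]
    congr 1
    · rw [mul_zero, zero_sub]
      rfl
    · refine NNReal.coe_injective ?_
      rw [Real.coe_toNNReal _ (mul_nonneg (sq_nonneg σ) d.2)]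
      rfl
  have hE : MeasurableSet {p : (Set.Iic s' → ℝ) × ℝ | p.1 ∈ A' ∧
      mulPos (start p.1) (expPos (drift p.2)) ∈ B} := by
    refine (measurable_fst hA').inter ?_
    have : Measurable fun p : (Set.Iic s' → ℝ) × ℝ => mulPos (start p.1) (expPos (drift p.2)) := by
      refine Measurable.subtype_mk ?_
      exact (measurable_subtype_coe.comp (hstart.comp measurable_fst)).mul
        (measurable_subtype_coe.comp (measurable_expPos.comp (hdrift.comp measurable_snd)))
    exact this hBm
  have hprod := (indepFun_iff_map_prod_eq_prod_map_map hpast.aemeasurable hincr.aemeasurable).1 hind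
  have h1 : Q (past ⁻¹' A' ∩ bsProcess 𝒯 σ S₀ W t ⁻¹' B) = (Q.map fun ω => (past ω, incr ω))
      {p | p.1 ∈ A' ∧ mulPos (start p.1) (expPos (drift p.2)) ∈ B} := by
    rw [Measure.map_apply (hpast.prodMk hincr) hE]
    congr 1
    ext ω
    simp only [Set.mem_inter_iff, Set.mem_preimage, Set.mem_ofPred_eq, hT]
  have hfin : IsFiniteMeasure (Q.map incr) := Measure.isFiniteMeasure_map _ _
  have hk : Measurable fun f : Set.Iic s' → ℝ =>
      (bsTransition 𝒯 σ).kernel s t (start f) B := (Kernel.measurable_coe _ hBm).comp hstart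
  rw [h1, hprod, Measure.prod_apply hE]
  simp_rw [hS]
  rw [← setLIntegral_map hA' hk hpast, ← lintegral_indicator hA']
  refine lintegral_congr fun f => ?_
  by_cases hf : f ∈ A'
  · rw [Set.indicator_of_mem hf]
    change _ = bsStep σ ((t : ℝ) - s) (start f) B
    have hed : Measurable fun z => expPos (drift z) := measurable_expPos.comp hdrift
    rw [bsStep_eq_map, ← hstep, Measure.map_apply (measurable_mulPos _) hBm,
      Measure.map_apply hed (measurable_mulPos _ hBm)]
    congr 1
    ext z
    simp [hf]
  · rw [Set.indicator_of_notMem hf]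
    have : Prod.mk f ⁻¹' {p : (Set.Iic s' → ℝ) × ℝ | p.1 ∈ A' ∧
        mulPos (start p.1) (expPos (drift p.2)) ∈ B} = ∅ := by
      ext z
      simp [hf]
    rw [this, measure_empty]

end BlackScholes

/-! ### The Kolmogorov extension theorem -/

section KolmogorovExtension

variable {ι E : Type*} [TopologicalSpace E]

/-- Finitely many cylinders at a time suffice to meet countably many cylinders with compact
bases. -/
theorem nonempty_iInter_cylinder_of_isCompact [T2Space E] {J : ℕ → Finset ι}
    {K : ∀ n, Set (J n → E)} (hK : ∀ n, IsCompact (K n))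
    (hne : ∀ n, (⋂ i ≤ n, cylinder (α := fun _ => E) (J i) (K i)).Nonempty) :
    (⋂ i, cylinder (α := fun _ => E) (J i) (K i)).Nonempty := by
  classical
  choose x hx using hne
  have hmem : ∀ m n, m ≤ n → (J m).restrict (x n) ∈ K m := fun m n hmn => by
    have := Set.mem_iInter₂.1 (hx n) m hmn
    exact this
  -- One ultrafilter serves all `m` simultaneously, so the limits are automatically compatible on
  -- overlapping index sets and no diagonal sequence is needed.
  have hlim : ∀ m, ∃ a ∈ K m,
      Tendsto (fun n => (J m).restrict (x n)) (hyperfilter ℕ : Filter ℕ) (𝓝 a) := by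
    intro m
    have h : ∀ᶠ n in (hyperfilter ℕ : Filter ℕ), (J m).restrict (x n) ∈ K m :=
      (Nat.hyperfilter_le_atTop) ((eventually_ge_atTop m).mono fun n hn => hmem m n hn)
    exact (hK m).ultrafilter_le_nhds ((hyperfilter ℕ).map fun n => (J m).restrict (x n))
      (le_principal_iff.2 h)
  choose a haK hat using hlim
  -- By uniqueness of limits the choice of `n` with `i ∈ J n` is immaterial; coordinates outside all
  -- `J n` are arbitrary.
  let z : ι → E := fun i => if h : ∃ n, i ∈ J n then a h.choose ⟨i, h.choose_spec⟩ else x 0 i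
  have hz : ∀ m, (J m).restrict z = a m := by
    intro m
    funext i
    have hex : ∃ n, (i : ι) ∈ J n := ⟨m, i.2⟩
    have hzi : z i = a hex.choose ⟨i, hex.choose_spec⟩ := dif_pos hex
    refine hzi.trans (tendsto_nhds_unique (f := fun n => x n i)
      (l := (hyperfilter ℕ : Filter ℕ)) ?_ ?_)
    · exact tendsto_pi_nhds.1 (hat hex.choose) ⟨i, hex.choose_spec⟩
    · exact tendsto_pi_nhds.1 (hat m) i
  refine ⟨z, Set.mem_iInter.2 fun m => ?_⟩
  rw [mem_cylinder, hz m]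
  exact haK m

variable [PolishSpace E] [MeasurableSpace E] [BorelSpace E]

/-- The **Kolmogorov extension theorem**: a projective family of probability measures on the
finite-dimensional products of a Polish space has a projective limit. -/
theorem exists_isProjectiveLimit {P : ∀ J : Finset ι, Measure (J → E)}
    [∀ J, IsProbabilityMeasure (P J)] (hP : IsProjectiveMeasureFamily (α := fun _ => E) P) :
    ∃ μ : Measure (ι → E), IsProjectiveLimit (α := fun _ => E) μ P := by
  set m := projectiveFamilyContent hP with hm
  have hring : IsSetRing (measurableCylinders fun _ : ι => E) := isSetRing_measurableCylinders
  have hzero : ∀ ⦃s : ℕ → Set (ι → E)⦄, (∀ n, s n ∈ measurableCylinders fun _ : ι => E) →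
      Antitone s → ⋂ n, s n = ∅ → Tendsto (fun n => m (s n)) atTop (𝓝 0) := by
    intro s hs hanti hempty
    have hmanti : Antitone fun n => m (s n) := fun a b hab =>
      projectiveFamilyContent_mono hP (hs b) (hs a) (hanti hab)
    have hinf := tendsto_atTop_iInf hmanti
    by_cases h0 : ⨅ n, m (s n) = 0
    · rwa [h0] at hinf
    exfalso
    have hcyl : ∀ n, ∃ (J : Finset ι) (S : Set (J → E)), MeasurableSet S ∧ s n = cylinder J S := by
      intro n
      exact (mem_measurableCylinders _).1 (hs n)
    choose J S hS hsS using hcyl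
    -- The compact inner approximations lose in total less than the assumed positive limit. If
    -- finitely many compact cylinders had empty intersection, the lost pieces would cover some `s
    -- n`, whose content is too large for that.
    obtain ⟨δ, hδ, hδsum⟩ := ENNReal.exists_pos_sum_of_countable' h0 ℕ
    have hcomp : ∀ n, ∃ K ⊆ S n, IsCompact K ∧ P (J n) (S n \ K) < δ n := fun n =>
      (hS n).exists_isCompact_sdiff_lt (measure_ne_top _ _) (hδ n).ne'
    choose K hKS hK hKδ using hcomp
    have hKm : ∀ n, MeasurableSet (K n) := fun n => (hK n).measurableSet
    have hne : ∀ n, (⋂ i ≤ n, cylinder (α := fun _ => E) (J i) (K i)).Nonempty := by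
      intro n
      by_contra hemp
      rw [Set.not_nonempty_iff_eq_empty] at hemp
      have hsub : s n ⊆ ⋃ i ≤ n, cylinder (α := fun _ => E) (J i) (S i \ K i) := by
        intro ω hω
        by_contra hnot
        have : ω ∈ ⋂ i ≤ n, cylinder (α := fun _ => E) (J i) (K i) := by
          refine Set.mem_iInter₂.2 fun i hi => ?_
          by_contra hki
          refine hnot (Set.mem_iUnion₂.2 ⟨i, hi, ?_⟩)
          have hi' : ω ∈ cylinder (J i) (S i) := by
            rw [← hsS i]
            exact hanti hi hω
          exact ⟨hi', hki⟩
        rw [hemp] at this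
        exact this
      have hmc : ∀ i, cylinder (α := fun _ => E) (J i) (S i \ K i)
          ∈ measurableCylinders fun _ : ι => E := fun i =>
        (mem_measurableCylinders _).2 ⟨J i, S i \ K i, (hS i).diff (hKm i), rfl⟩
      have hUnion : (⋃ i ≤ n, cylinder (α := fun _ => E) (J i) (S i \ K i))
          ∈ measurableCylinders fun _ : ι => E := hring.iUnion_le_mem hmc n
      have h1 : m (s n) ≤ ∑ i ∈ Finset.range (n + 1), δ i :=
        calc m (s n) ≤ m (⋃ i ≤ n, cylinder (α := fun _ => E) (J i) (S i \ K i)) :=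
              projectiveFamilyContent_mono hP (hs n) hUnion hsub
          _ ≤ ∑ i ∈ Finset.range (n + 1), m (cylinder (α := fun _ => E) (J i) (S i \ K i)) :=
              projectiveFamilyContent_iUnion_le hP hmc n
          _ ≤ ∑ i ∈ Finset.range (n + 1), δ i := by
              refine Finset.sum_le_sum fun i _ => ?_
              rw [hm, projectiveFamilyContent_cylinder hP ((hS i).diff (hKm i))]
              exact (hKδ i).le
      exact absurd (((iInf_le _ n).trans h1).trans (ENNReal.sum_le_tsum _)) (not_le.2 hδsum)
    obtain ⟨ω, hω⟩ := nonempty_iInter_cylinder_of_isCompact hK hne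
    have : ω ∈ ⋂ n, s n := by
      refine Set.mem_iInter.2 fun n => ?_
      rw [hsS n]
      exact hKS n (Set.mem_iInter.1 hω n)
    rw [hempty] at this
    exact this
  have hσ : m.IsSigmaSubadditive := isSigmaSubadditive_of_addContent_iUnion_eq_tsum hring
    (addContent_iUnion_eq_sum_of_tendsto_zero hring m
      (fun s _ => projectiveFamilyContent_ne_top hP) hzero)
  have hgen : (inferInstance : MeasurableSpace (ι → E)) =
      MeasurableSpace.generateFrom (measurableCylinders fun _ : ι => E) :=
    generateFrom_measurableCylinders.symm
  refine ⟨m.measure hring.isSetSemiring hgen.le hσ, fun I => ?_⟩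
  ext S hS
  rw [Measure.map_apply (Finset.measurable_restrict I) hS]
  refine (m.measure_eq hring.isSetSemiring hgen hσ
    ((mem_measurableCylinders _).2 ⟨I, S, hS, rfl⟩)).trans ?_
  exact projectiveFamilyContent_cylinder hP hS

end KolmogorovExtension

instance : PolishSpace Pos := isOpen_Ioi.polishSpace

/-! ### Markov processes with a given transition function -/

namespace TransitionFunction

theorem dependsOn_indicator_one {I : Type*} {A : Set (I → Pos)} {T : Set I}
    (h : ∀ ω ω' : I → Pos, (∀ i ∈ T, ω i = ω' i) → (ω ∈ A ↔ ω' ∈ A)) :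
    DependsOn (A.indicator (1 : (I → Pos) → ℝ≥0∞)) T := by
  classical
  intro ω ω' hω
  simp only [Set.indicator_apply, Pi.one_apply]
  exact if_congr (h ω ω' hω) rfl rfl

section Construction

variable {I : Type*} [LinearOrder I] (κ : TransitionFunction I) {s t : I}

/-- Resample the price at time `t` given the price at time `s`. -/
noncomputable def resample (s t : I) : Kernel (I → Pos) (I → Pos) :=
  (Kernel.id ×ₖ (κ.kernel s t).comap (fun ω : I → Pos => ω s) (measurable_pi_apply s)).map
    (fun p => Function.update p.1 t p.2)

/-- The law of a path which is constant with law `ν` except for the given times, where it is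
resampled successively, starting with the last one in the list. -/
noncomputable def chainLaw (t₀ : I) (ν : Measure Pos) : List I → Measure (I → Pos)
  | [] => ν.map fun x _ => x
  | t :: l => (chainLaw t₀ ν l).bind (κ.resample (l.headD t₀) t)

variable {κ}

theorem measurable_update_prod (t : I) :
    Measurable fun p : (I → Pos) × Pos => Function.update p.1 t p.2 :=
  measurable_update'

theorem lintegral_resample (hst : s ≤ t) {f : (I → Pos) → ℝ≥0∞} (hf : Measurable f)
    (ω : I → Pos) :
    ∫⁻ ω', f ω' ∂κ.resample s t ω = ∫⁻ y, f (Function.update ω t y) ∂κ.kernel s t (ω s) := by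
  have := κ.markov s t hst
  rw [resample, Kernel.map_apply _ (measurable_update_prod t),
    lintegral_map hf (measurable_update_prod t), Kernel.prod_apply, Kernel.id_apply,
    Kernel.comap_apply,
    lintegral_prod (fun p : (I → Pos) × Pos => f (Function.update p.1 t p.2))
      (hf.comp (measurable_update_prod t)).aemeasurable, lintegral_dirac']
  exact (hf.comp (measurable_update_prod t)).lintegral_prod_right'

theorem measurable_lintegral_update (hst : s ≤ t) {f : (I → Pos) → ℝ≥0∞} (hf : Measurable f) :
    Measurable fun ω : I → Pos => ∫⁻ y, f (Function.update ω t y) ∂κ.kernel s t (ω s) := by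
  simp_rw [← lintegral_resample hst hf]
  exact hf.lintegral_kernel

variable {t₀ : I} {ν : Measure Pos}

theorem headD_le (ht₀ : ∀ t, t₀ ≤ t) {l : List I} (hl : (t :: l).Pairwise (· > ·)) :
    l.headD t₀ ≤ t := by
  cases l with
  | nil => exact ht₀ t
  | cons u l => exact (List.rel_of_pairwise_cons hl (List.mem_cons_self ..)).le

theorem lintegral_chainLaw_cons (ht₀ : ∀ t, t₀ ≤ t) {l : List I}
    (hl : (t :: l).Pairwise (· > ·)) {f : (I → Pos) → ℝ≥0∞} (hf : Measurable f) :
    ∫⁻ ω, f ω ∂κ.chainLaw t₀ ν (t :: l) =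
      ∫⁻ ω, ∫⁻ y, f (Function.update ω t y) ∂κ.kernel (l.headD t₀) t (ω (l.headD t₀))
        ∂κ.chainLaw t₀ ν l := by
  rw [chainLaw, Measure.lintegral_bind (Kernel.aemeasurable _) hf.aemeasurable]
  exact lintegral_congr fun ω => lintegral_resample (headD_le ht₀ hl) hf ω

/-- Times on which a functional of the path does not depend can be left out. -/
theorem lintegral_chainLaw_append_cons (ht₀ : ∀ t, t₀ ≤ t) (t : I) (l : List I) :
    ∀ (l' : List I), (l' ++ t :: l).Pairwise (· > ·) → ∀ {f : (I → Pos) → ℝ≥0∞}, Measurable f →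
      (∀ ω y, f (Function.update ω t y) = f ω) →
      ∫⁻ ω, f ω ∂κ.chainLaw t₀ ν (l' ++ t :: l) = ∫⁻ ω, f ω ∂κ.chainLaw t₀ ν (l' ++ l)
  -- If `t` is the latest time, its kernel simply integrates to one.
  | [], hl, f, hf, hft => by
    have := κ.markov _ _ (headD_le ht₀ hl)
    simp only [List.nil_append] at hl ⊢
    rw [lintegral_chainLaw_cons ht₀ hl hf]
    refine lintegral_congr fun ω => ?_
    simp only [hft, lintegral_const, measure_univ, mul_one]
  -- If only `u` comes after `t`, Chapman–Kolmogorov merges the steps into and out of `t`.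
  | [u], hl, f, hf, hft => by
    simp only [List.cons_append, List.nil_append] at hl ⊢
    have hl' := (List.pairwise_cons.1 hl).2
    have htu : t < u := List.rel_of_pairwise_cons hl (List.mem_cons_self ..)
    have hl'' : (u :: l).Pairwise (· > ·) :=
      List.pairwise_cons.2 ⟨fun a ha => List.rel_of_pairwise_cons hl (List.mem_cons_of_mem _ ha),
        (List.pairwise_cons.1 hl').2⟩
    rw [lintegral_chainLaw_cons ht₀ hl hf, List.headD_cons,
      lintegral_chainLaw_cons ht₀ hl' (measurable_lintegral_update htu.le hf),
      lintegral_chainLaw_cons ht₀ hl'' hf]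
    refine lintegral_congr fun ω => ?_
    have hfu : Measurable fun y => f (Function.update ω u y) := hf.comp (measurable_update ω)
    rw [← κ.chapman_kolmogorov _ t u (headD_le ht₀ hl') htu.le, Kernel.lintegral_comp _ _ _ hfu]
    refine lintegral_congr fun z => ?_
    rw [Function.update_self]
    refine lintegral_congr fun y => ?_
    rw [Function.update_comm htu.ne, hft]
  -- Otherwise the latest time `u` is integrated out. Its kernel reads the path at `v ≠ t`, so the
  -- new functional still ignores time `t` and the recursion applies.
  | u :: v :: l', hl, f, hf, hft => by
    simp only [List.cons_append] at hl ⊢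
    have hvu : v < u := List.rel_of_pairwise_cons hl (List.mem_cons_self ..)
    have htu : t < u := List.rel_of_pairwise_cons hl (by simp)
    have hl' := (List.pairwise_cons.1 hl).2
    have htv : t < v := List.rel_of_pairwise_cons hl' (by simp)
    have hl'' : (u :: v :: (l' ++ l)).Pairwise (· > ·) :=
      hl.sublist (by simp)
    rw [lintegral_chainLaw_cons ht₀ hl hf, lintegral_chainLaw_cons ht₀ hl'' hf]
    simp only [List.headD_cons]
    refine lintegral_chainLaw_append_cons ht₀ t l (v :: l') hl'
      (measurable_lintegral_update hvu.le hf) fun ω z => ?_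
    rw [Function.update_of_ne htv.ne']
    refine lintegral_congr fun y => ?_
    rw [Function.update_comm htu.ne, hft]

theorem isProbabilityMeasure_chainLaw (ht₀ : ∀ t, t₀ ≤ t) [IsProbabilityMeasure ν] :
    ∀ l : List I, l.Pairwise (· > ·) → IsProbabilityMeasure (κ.chainLaw t₀ ν l)
  | [], _ => by
    rw [chainLaw]
    exact Measure.isProbabilityMeasure_map (measurable_pi_lambda _ fun _ => measurable_id).aemeasurable
  | t :: l, hl => by
    have := κ.markov _ _ (headD_le ht₀ hl)
    have := isProbabilityMeasure_chainLaw ht₀ l (List.pairwise_cons.1 hl).2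
    constructor
    rw [← lintegral_one, lintegral_chainLaw_cons ht₀ hl measurable_const]
    simp only [lintegral_const, measure_univ, mul_one]

variable (κ t₀ ν) in
/-- The law of a path resampled at the times of a finite set. -/
noncomputable def finLaw (J : Finset I) : Measure (I → Pos) :=
  κ.chainLaw t₀ ν (J.sort (· ≥ ·))

theorem pairwise_gt_sort (J : Finset I) : (J.sort (· ≥ ·)).Pairwise (· > ·) :=
  J.sortedGT_sort.pairwise

theorem lintegral_finLaw_insert (ht₀ : ∀ t, t₀ ≤ t) {J : Finset I} (ht : t ∉ J)
    {f : (I → Pos) → ℝ≥0∞} (hf : Measurable f) (hft : ∀ ω y, f (Function.update ω t y) = f ω) :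
    ∫⁻ ω, f ω ∂κ.finLaw t₀ ν (insert t J) = ∫⁻ ω, f ω ∂κ.finLaw t₀ ν J := by
  have hmem : t ∈ (insert t J).sort (· ≥ ·) := by simp
  obtain ⟨l₁, l₂, hl⟩ := List.append_of_mem hmem
  have hp := pairwise_gt_sort (insert t J)
  rw [hl] at hp
  have hnd : (l₁ ++ t :: l₂).Nodup := hl ▸ Finset.sort_nodup _ _
  have hp' : (l₁ ++ l₂).Pairwise (· > ·) := hp.sublist (by simp)
  have hJ : (l₁ ++ l₂).toFinset = J := by
    have h1 : (l₁ ++ t :: l₂).toFinset = insert t J := by rw [← hl, Finset.sort_toFinset]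
    have h2 : t ∉ (l₁ ++ l₂).toFinset := by
      rw [List.mem_toFinset]
      exact (List.nodup_middle.1 hnd).notMem
    have h3 : insert t (l₁ ++ l₂).toFinset = insert t J := by
      rw [← h1]
      ext
      simp
    rw [← Finset.erase_insert h2, h3, Finset.erase_insert ht]
  have hsort : J.sort (· ≥ ·) = l₁ ++ l₂ := by
    rw [← hJ]
    exact (List.toFinset_sort (· ≥ ·) (hp'.imp fun h => ne_of_gt h)).2 (hp'.imp fun h => le_of_lt h)
  rw [finLaw, finLaw, hl, hsort]
  exact lintegral_chainLaw_append_cons ht₀ t l₂ l₁ hp hf hft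

theorem lintegral_finLaw_of_subset (ht₀ : ∀ t, t₀ ≤ t) {J K : Finset I} (hJK : J ⊆ K)
    {f : (I → Pos) → ℝ≥0∞} (hf : Measurable f) (hfJ : DependsOn f (J : Set I)) :
    ∫⁻ ω, f ω ∂κ.finLaw t₀ ν K = ∫⁻ ω, f ω ∂κ.finLaw t₀ ν J := by
  have key : ∀ D : Finset I, ∫⁻ ω, f ω ∂κ.finLaw t₀ ν (D ∪ J) = ∫⁻ ω, f ω ∂κ.finLaw t₀ ν J := by
    intro D
    induction D using Finset.induction_on with
    | empty => rw [Finset.empty_union]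
    | insert t D _ ih =>
      rw [Finset.insert_union]
      by_cases ht : t ∈ D ∪ J
      · rw [Finset.insert_eq_of_mem ht, ih]
      · rw [lintegral_finLaw_insert ht₀ ht hf, ih]
        intro ω y
        refine hfJ fun i hi => Function.update_of_ne ?_ _ _
        rintro rfl
        exact ht (Finset.mem_union_right _ hi)
  rw [← key K, Finset.union_eq_left.2 hJK]

/-- Consistent finite-dimensional distributions of a Markov process. -/
theorem isProjectiveMeasureFamily_finLaw (ht₀ : ∀ t, t₀ ≤ t) :
    IsProjectiveMeasureFamily (α := fun _ : I => Pos)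
      fun J : Finset I => (κ.finLaw t₀ ν J).map J.restrict := by
  intro K J hJK
  have hJ : Measurable (J.restrict (π := fun _ : I => Pos)) := Finset.measurable_restrict J
  ext S hS
  rw [Measure.map_map (Finset.measurable_restrict₂ hJK) (Finset.measurable_restrict K),
    Finset.restrict₂_comp_restrict, Measure.map_apply hJ hS, Measure.map_apply hJ hS,
    ← lintegral_indicator_one (hJ hS), ← lintegral_indicator_one (hJ hS)]
  refine (lintegral_finLaw_of_subset ht₀ hJK (measurable_one.indicator (hJ hS))
    (dependsOn_indicator_one fun ω ω' h => ?_)).symm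
  have : J.restrict ω = J.restrict ω' := funext fun i => h i i.2
  rw [Set.mem_preimage, Set.mem_preimage, this]

variable (κ ν) in
/-- There is a law on the space of all paths that has the finite-dimensional distributions of a
Markov process. -/
theorem exists_pathLaw [IsProbabilityMeasure ν] (ht₀ : ∀ t, t₀ ≤ t) :
    ∃ μ : Measure (I → Pos), IsProbabilityMeasure μ ∧
      ∀ (J : Finset I) (f : (I → Pos) → ℝ≥0∞), Measurable f → DependsOn f (J : Set I) →
        ∫⁻ ω, f ω ∂μ = ∫⁻ ω, f ω ∂κ.finLaw t₀ ν J := by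
  have hprob : ∀ J : Finset I, IsProbabilityMeasure ((κ.finLaw t₀ ν J).map J.restrict) := fun J => by
    have : IsProbabilityMeasure (κ.finLaw t₀ ν J) :=
      isProbabilityMeasure_chainLaw ht₀ _ (pairwise_gt_sort J)
    exact Measure.isProbabilityMeasure_map (Finset.measurable_restrict J).aemeasurable
  obtain ⟨μ, hμ⟩ := exists_isProjectiveLimit
    (isProjectiveMeasureFamily_finLaw (κ := κ) (ν := ν) ht₀)
  refine ⟨μ, hμ.isProbabilityMeasure, fun J f hf hfJ => ?_⟩
  -- A path on `J` is extended by the arbitrary value `1`, which `f` does not see.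
  let e : (J → Pos) → I → Pos := fun x i => if h : i ∈ J then x ⟨i, h⟩ else onePos
  have he : Measurable e := measurable_pi_lambda _ fun i => by
    by_cases h : i ∈ J
    · simpa [e, h] using measurable_pi_apply _
    · simp [e, h]
  have hfe : ∀ ω, f ω = f (e (J.restrict ω)) := fun ω => hfJ fun i hi => by
    simp [e, Finset.mem_coe.1 hi]
  have hJ : Measurable (J.restrict (π := fun _ : I => Pos)) := Finset.measurable_restrict J
  calc ∫⁻ ω, f ω ∂μ = ∫⁻ ω, f (e (J.restrict ω)) ∂μ := lintegral_congr hfe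
    _ = ∫⁻ x, f (e x) ∂(μ.map J.restrict) := (lintegral_map (hf.comp he) hJ).symm
    _ = ∫⁻ ω, f (e (J.restrict ω)) ∂κ.finLaw t₀ ν J := by
      rw [hμ J]
      exact lintegral_map (hf.comp he) hJ
    _ = ∫⁻ ω, f ω ∂κ.finLaw t₀ ν J := (lintegral_congr hfe).symm

/-- Resampling at the initial time uses the identity kernel and so keeps the law `ν`. -/
theorem finLaw_singleton (ht₀ : ∀ t, t₀ ≤ t) {B : Set Pos} (hB : MeasurableSet B) :
    ∫⁻ ω, B.indicator 1 (ω t₀) ∂κ.finLaw t₀ ν {t₀} = ν B := by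
  have hb : Measurable fun ω : I → Pos => B.indicator (1 : Pos → ℝ≥0∞) (ω t₀) :=
    (measurable_one.indicator hB).comp (measurable_pi_apply t₀)
  have hc : Measurable fun (x : Pos) (_ : I) => x := measurable_pi_lambda _ fun _ => measurable_id
  rw [finLaw, Finset.sort_singleton, lintegral_chainLaw_cons ht₀ (List.pairwise_singleton _ _) hb,
    List.headD_nil, κ.refl, chainLaw]
  simp only [Function.update_self, Kernel.id_apply]
  simp_rw [lintegral_dirac' _ (measurable_one.indicator hB)]
  rw [lintegral_map hb hc, lintegral_indicator_one hB]

/-- Here `t` and `s` head the decreasing list of times, so the outermost step of the chain is the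
transition from `s` to `t`. This is the Markov property at the level of finite-dimensional laws. -/
theorem lintegral_finLaw_insert_insert (ht₀ : ∀ t, t₀ ≤ t) (hst : s < t) {J : Finset I}
    (hJ : ∀ j ∈ J, j ≤ s) {f : (I → Pos) → ℝ≥0∞} (hf : Measurable f) :
    ∫⁻ ω, f ω ∂κ.finLaw t₀ ν (insert t (insert s J)) =
      ∫⁻ ω, ∫⁻ y, f (Function.update ω t y) ∂κ.kernel s t (ω s)
        ∂κ.finLaw t₀ ν (insert s J) := by
  have hs : (insert s J).sort (· ≥ ·) = s :: (J.erase s).sort (· ≥ ·) := by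
    rw [← Finset.insert_erase (Finset.mem_insert_self s J), Finset.erase_insert_eq_erase]
    exact Finset.sort_insert _ (fun b hb => hJ b (Finset.mem_of_mem_erase hb))
      (Finset.notMem_erase _ _)
  have hlt : ∀ b ∈ insert s J, b < t := fun b hb => by
    rcases Finset.mem_insert.1 hb with rfl | hb
    · exact hst
    · exact (hJ b hb).trans_lt hst
  have ht : (insert t (insert s J)).sort (· ≥ ·) = t :: s :: (J.erase s).sort (· ≥ ·) := by
    rw [Finset.sort_insert _ (fun b hb => (hlt b hb).le) fun h => (hlt t h).false, hs]
  have hp := pairwise_gt_sort (insert t (insert s J))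
  rw [ht] at hp
  rw [finLaw, finLaw, ht, hs, lintegral_chainLaw_cons ht₀ hp hf]
  rfl

end Construction

/-- Every transition function belongs to a Markov process with given initial distribution. -/
theorem exists_markovian_pathLaw {I : Type*} [LinearOrder I] (κ : TransitionFunction I) {t₀ : I}
    (ht₀ : ∀ t, t₀ ≤ t) (ν : Measure Pos) [IsProbabilityMeasure ν] :
    ∃ (μ : Measure (I → Pos)) (ℱ : Filtration I (inferInstance : MeasurableSpace (I → Pos))),
      IsProbabilityMeasure μ ∧ IsMarkovProcess κ (fun t ω => ω t) ℱ μ ∧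
        μ.map (fun ω => ω t₀) = ν := by
  obtain ⟨μ, hμp, hμ⟩ := κ.exists_pathLaw ν ht₀
  have hX : ∀ t : I, StronglyMeasurable fun ω : I → Pos => ω t := fun t =>
    (measurable_pi_apply t).stronglyMeasurable
  refine ⟨μ, Filtration.natural (fun t ω => ω t) hX, hμp, ?_, ?_⟩
  · refine IsMarkovProcess.of_measure_inter (fun t => ?_) fun s t hst => ?_
    · exact (Filtration.stronglyAdapted_natural hX t).measurable
    -- Cylinders over finitely many times up to `s` form a `π`-system generating the natural
    -- filtration at `s`, so the Markov property only concerns finite-dimensional laws.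
    let C : Set (Set (I → Pos)) := {A | ∃ J : Finset I, (∀ j ∈ J, j ≤ s) ∧
      ∃ S : Set (J → Pos), MeasurableSet S ∧ A = cylinder (α := fun _ => Pos) J S}
    have huniv : Set.univ ∈ C := ⟨∅, by simp, Set.univ, MeasurableSet.univ, (cylinder_univ _).symm⟩
    refine ⟨C, le_antisymm ?_ ?_, ?_, ?_⟩
    · refine iSup₂_le fun j hj => ?_
      rintro _ ⟨B, hB, rfl⟩
      refine MeasurableSpace.measurableSet_generateFrom ⟨{j}, by simpa using hj,
        (fun x => x ⟨j, Finset.mem_singleton_self j⟩) ⁻¹' B, ?_, rfl⟩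
      exact measurable_pi_apply _ hB
    · refine MeasurableSpace.generateFrom_le ?_
      rintro _ ⟨J, hJ, S, hS, rfl⟩
      have : Measurable[Filtration.natural (fun t (ω : I → Pos) => ω t) hX s]
          (J.restrict (π := fun _ : I => Pos)) :=
        @measurable_pi_iff _ _ _ (Filtration.natural (fun t (ω : I → Pos) => ω t) hX s) _ _ |>.2
          fun j =>
          (Filtration.stronglyAdapted_natural hX (j : I)).measurable.mono
            ((Filtration.natural (fun t (ω : I → Pos) => ω t) hX).mono (hJ j j.2)) le_rfl
      exact this hS
    · rintro _ ⟨J, hJ, S, hS, rfl⟩ _ ⟨J', hJ', S', hS', rfl⟩ -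
      refine ⟨J ∪ J', fun j hj => (Finset.mem_union.1 hj).elim (hJ j) (hJ' j), _, ?_,
        inter_cylinder _ _ _ _⟩
      exact (Finset.measurable_restrict₂ _ hS).inter (Finset.measurable_restrict₂ _ hS')
    · classical
      intro A hA B hB
      replace hA : A ∈ C := hA.elim id fun h => by rwa [Set.mem_singleton_iff.1 h]
      obtain ⟨J, hJ, S, hS, rfl⟩ := hA
      have hcyl : MeasurableSet (cylinder (α := fun _ : I => Pos) J S) := hS.cylinder J
      have hXt : MeasurableSet ((fun ω : I → Pos => ω t) ⁻¹' B) := measurable_pi_apply t hB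
      have hk : Measurable fun ω : I → Pos => κ.kernel s t (ω s) B :=
        (Kernel.measurable_coe _ hB).comp (measurable_pi_apply s)
      rcases hst.eq_or_lt with rfl | hlt
      · rw [κ.refl, Set.inter_comm, ← Measure.restrict_apply hXt, ← lintegral_indicator_one hXt]
        refine lintegral_congr fun ω => ?_
        rw [Kernel.id_apply, Measure.dirac_apply' _ hB]
        rfl
      have hdep : ∀ {ω ω' : I → Pos}, (∀ i ∈ J, ω i = ω' i) →
          (ω ∈ cylinder (α := fun _ : I => Pos) J S ↔ ω' ∈ cylinder (α := fun _ : I => Pos) J S) :=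
        fun {ω ω'} h => by
          have : J.restrict ω = J.restrict ω' := funext fun i => h i i.2
          rw [mem_cylinder, mem_cylinder, this]
      rw [← lintegral_indicator_one (hcyl.inter hXt), ← lintegral_indicator hcyl,
        hμ (insert t (insert s J)) _ (measurable_one.indicator (hcyl.inter hXt)),
        hμ (insert s J) _ (hk.indicator hcyl),
        lintegral_finLaw_insert_insert ht₀ hlt hJ (measurable_one.indicator (hcyl.inter hXt))]
      · refine lintegral_congr fun ω => ?_
        have hup : ∀ y, Function.update ω t y ∈ cylinder (α := fun _ : I => Pos) J S ↔
            ω ∈ cylinder (α := fun _ : I => Pos) J S := fun y => hdep fun i hi =>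
          Function.update_of_ne ((hJ i hi).trans_lt hlt).ne _ _
        by_cases hω : ω ∈ cylinder (α := fun _ : I => Pos) J S
        · rw [Set.indicator_of_mem hω, ← lintegral_indicator_one hB]
          refine lintegral_congr fun y => ?_
          simp only [Set.indicator_apply, Set.mem_inter_iff, hup, hω, Set.mem_preimage, true_and,
            Function.update_self, Pi.one_apply]
        · rw [Set.indicator_of_notMem hω]
          simp only [Set.indicator_apply, Set.mem_inter_iff, hup, hω, false_and, if_false,
            lintegral_zero]
      · intro ω ω' h
        have h1 := hdep fun i hi => h i (by simp [hi])
        have h2 := h s (by simp)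
        simp only [Set.indicator_apply, h2]
        exact if_congr h1 rfl rfl
      · refine dependsOn_indicator_one fun ω ω' h => ?_
        have h1 := hdep fun i hi => h i (by simp [hi])
        have h2 := h t (by simp)
        rw [Set.mem_inter_iff, Set.mem_inter_iff, Set.mem_preimage, Set.mem_preimage, h1, h2]
  · ext B hB
    rw [Measure.map_apply (measurable_pi_apply t₀) hB,
      ← lintegral_indicator_one (measurable_pi_apply t₀ hB), ← finLaw_singleton (κ := κ) ht₀ hB]
    refine hμ {t₀} _ (measurable_one.indicator (measurable_pi_apply t₀ hB))
      (dependsOn_indicator_one fun ω ω' h => ?_)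
    rw [Set.mem_preimage, Set.mem_preimage, h t₀ (by simp)]

end TransitionFunction

/-! ### Martingale property of the adjoint -/

namespace TransitionFunction

/-- The laws `Γ_{s,t}(k | k') dk'` have mean `k`. -/
theorem IsMartingale.lintegral_coe_gammaKernel {I : Type*} [Preorder I] {κ : TransitionFunction I}
    {s t : I} (hκ : κ.IsMartingale) (hr : κ.SpotRegular) (hst : s < t) (k : Pos) :
    ∫⁻ k', ENNReal.ofReal (k' : ℝ) ∂(κ.gammaKernel s t k) = ENNReal.ofReal k := by
  have := hκ.isMarkovKernel_gammaKernel hr hst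
  have hk : (0 : ℝ) < k := k.2
  have hcast : Tendsto (fun n : ℕ => (n : ℝ) + 1) atTop atTop :=
    tendsto_atTop_add_const_right _ _ tendsto_natCast_atTop_atTop
  have hput : Tendsto (fun n : ℕ => κ.put s t k ((n : ℝ) + 1)) atTop (𝓝 0) :=
    (hr.put_tendsto s t hst k hk).comp hcast
  have h1 : Tendsto (fun n : ℕ =>
      ∫⁻ k', ENNReal.ofReal (min (k' : ℝ) ((n : ℝ) + 1)) ∂(κ.gammaKernel s t k)) atTop
      (𝓝 (∫⁻ k', ENNReal.ofReal (k' : ℝ) ∂(κ.gammaKernel s t k))) := by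
    refine lintegral_tendsto_of_tendsto_of_monotone (fun n => by fun_prop)
      (Eventually.of_forall fun k' m n hmn => ?_) (Eventually.of_forall fun k' => ?_)
    · exact ENNReal.ofReal_le_ofReal (min_le_min le_rfl (by gcongr))
    · refine tendsto_const_nhds.congr' ?_
      filter_upwards [hcast.eventually_ge_atTop (k' : ℝ)] with n hn
      rw [min_eq_left hn]
  have h2 : Tendsto (fun n : ℕ => ENNReal.ofReal ((k : ℝ) - κ.put s t k ((n : ℝ) + 1))) atTop
      (𝓝 (ENNReal.ofReal k)) := by
    have := ENNReal.tendsto_ofReal (tendsto_const_nhds (x := (k : ℝ)) |>.sub hput)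
    rwa [sub_zero] at this
  refine tendsto_nhds_unique (h1.congr' ?_) h2
  filter_upwards [hcast.eventually_ge_atTop (k : ℝ), hput.eventually_lt_const hk] with n hn hpn
  have hn0 : (0 : ℝ) < n + 1 := by positivity
  have hp0 : 0 ≤ κ.put s t k ((n : ℝ) + 1) := κ.put_nonneg s t k _
  have h3 := hκ.lintegral_gammaKernel hr hst k ⟨(n : ℝ) + 1, hn0⟩
  rw [← hκ.ofReal_call hst.le] at h3
  -- The truncated price and the put with strike `n + 1` add up to `n + 1`. Duality gives the value
  -- of the put, so the truncated mean is `k - P(n + 1)`.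
  have h4 : ∫⁻ k', ENNReal.ofReal (min (k' : ℝ) ((n : ℝ) + 1)) ∂(κ.gammaKernel s t k) +
      ∫⁻ k', ENNReal.ofReal ((n : ℝ) + 1 - k') ∂(κ.gammaKernel s t k) =
        ENNReal.ofReal ((n : ℝ) + 1) := by
    rw [← lintegral_add_left (by fun_prop)]
    have : ∀ k' : Pos, ENNReal.ofReal (min (k' : ℝ) ((n : ℝ) + 1)) +
        ENNReal.ofReal ((n : ℝ) + 1 - k') = ENNReal.ofReal ((n : ℝ) + 1) := by
      intro k'
      have hk' : (0 : ℝ) < k' := k'.2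
      rcases le_total (k' : ℝ) ((n : ℝ) + 1) with h | h
      · rw [min_eq_left h, ← ENNReal.ofReal_add hk'.le (by linarith)]
        ring_nf
      · rw [min_eq_right h, ENNReal.ofReal_of_nonpos (by linarith : (n : ℝ) + 1 - k' ≤ 0), add_zero]
    simp_rw [this]
    rw [lintegral_const, measure_univ, mul_one]
  refine (ENNReal.add_left_inj (a := ENNReal.ofReal
    (κ.put s t k ((n : ℝ) + 1) - k + ((n : ℝ) + 1))) ENNReal.ofReal_ne_top).1 ?_
  rw [← ENNReal.ofReal_add (by linarith) (by linarith)]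
  refine (congrArg _ h3.symm).trans (h4.trans ?_)
  congr 1
  ring

variable {𝒯 : ReversibleTimes} {κ κ' : TransitionFunction 𝒯.times}

theorem IsMartingale.isMartingale_reverse (hκ : κ.IsMartingale) (hr : κ.SpotRegular)
    (h : IsReverseGammaAdjointKernel κ κ') : κ'.IsMartingale := by
  refine isMartingale_of_lintegral fun t t' ht k => ?_
  have hlt := 𝒯.rev_lt_rev ht
  rw [(h t t' ht k).2, ← hκ.lintegral_coe_gammaKernel hr hlt k, hr.gammaKernel_apply hlt]
  rfl

end TransitionFunction

/-! ### The main theorem -/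

theorem mainTheorem8 (𝒯 : ReversibleTimes) (κ : TransitionFunction 𝒯.times)
    (hκ : κ.ContinuouslyDistributed)
    {Ω : Type*} [mΩ : MeasurableSpace Ω] (Q : Measure Ω) [IsProbabilityMeasure Q]
    (𝓖 : Filtration 𝒯.times mΩ) (S : 𝒯.times → Ω → Pos) (hS : IsMarkovProcess κ S 𝓖 Q) :
    -- under (A2), the process is a martingale only if its transition function is
    (κ.ScalingProperty → Martingale (fun t ω => (S t ω : ℝ)) 𝓖 Q → κ.IsMartingale) ∧
    -- (a)
    (κ.IsMartingale → (κ.ScalingProperty ∨ κ.SpotRegular) →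
      (∀ t t' : 𝒯.times, t < t' → ∀ k : Pos,
        (∀ k' : Pos, 0 ≤ κ.gamma (𝒯.rev t') (𝒯.rev t) k k') ∧
        ∫⁻ k' : Pos, ENNReal.ofReal (κ.gamma (𝒯.rev t') (𝒯.rev t) k k') = 1) ∧
      (∀ t t' t'' : 𝒯.times, t < t' → t' < t'' → ∀ k : Pos, ∀ᵐ k'' : Pos,
        ENNReal.ofReal (κ.gamma (𝒯.rev t'') (𝒯.rev t) k k'') =
          ∫⁻ k' : Pos, ENNReal.ofReal (κ.gamma (𝒯.rev t') (𝒯.rev t) k k') *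
            ENNReal.ofReal (κ.gamma (𝒯.rev t'') (𝒯.rev t') k' k'')) ∧
      ∃ κ' : TransitionFunction 𝒯.times, IsReverseGammaAdjointKernel κ κ') ∧
    -- (b), with an arbitrary initial distribution `ν`
    (κ.IsMartingale → (κ.ScalingProperty ∨ κ.SpotRegular) →
      ∀ (ν : Measure Pos) [IsProbabilityMeasure ν],
        ∃ (κ' : TransitionFunction 𝒯.times) (Ω' : Type) (mΩ' : MeasurableSpace Ω')
          (Q' : Measure Ω') (𝓖' : Filtration 𝒯.times mΩ') (S' : 𝒯.times → Ω' → Pos),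
          IsProbabilityMeasure Q' ∧ IsReverseGammaAdjointKernel κ κ' ∧
          IsMarkovProcess κ' S' 𝓖' Q' ∧ Q'.map (S' 𝒯.start) = ν) ∧
    -- (c), (d), (e): properties of any reverse Γ-adjoint process `S'` on `(Ω', Q')`
    (∀ (κ' : TransitionFunction 𝒯.times), IsReverseGammaAdjointKernel κ κ' →
      ∀ {Ω' : Type*} [mΩ' : MeasurableSpace Ω'] (Q' : Measure Ω') [IsProbabilityMeasure Q']
        (𝓖' : Filtration 𝒯.times mΩ') (S' : 𝒯.times → Ω' → Pos), IsMarkovProcess κ' S' 𝓖' Q' →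
      -- (c)
      (κ.IsMartingale → (κ.ScalingProperty ∨ κ.SpotRegular) →
        κ'.IsMartingale ∧
        (Integrable (fun ω => (S' 𝒯.start ω : ℝ)) Q' →
          Martingale (fun t ω => (S' t ω : ℝ)) 𝓖' Q')) ∧
      -- (d)
      (κ.ScalingProperty →
        κ'.ScalingProperty ∧
        ∀ t t' : 𝒯.times, t < t' →
          HasPDF (fun ω => Real.log ((S (𝒯.rev t) ω : ℝ) / S (𝒯.rev t') ω)) Q volume ∧
          HasPDF (fun ω => Real.log ((S' t' ω : ℝ) / S' t ω)) Q' volume ∧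
          ∀ᵐ ξ : ℝ, pdf (fun ω => Real.log ((S' t' ω : ℝ) / S' t ω)) Q' volume ξ =
            ENNReal.ofReal (Real.exp (-ξ)) *
              pdf (fun ω => Real.log ((S (𝒯.rev t) ω : ℝ) / S (𝒯.rev t') ω)) Q volume (-ξ)) ∧
      -- (e), put-call symmetry
      (κ.ScalingProperty → κ.PutCallSymmetry →
        ∀ t t' : 𝒯.times, t < t' →
          IdentDistrib (fun ω => (S' t' ω : ℝ) / S' t ω)
            (fun ω => (S (𝒯.rev t) ω : ℝ) / S (𝒯.rev t') ω) Q' Q)) ∧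
    -- (e), Black–Scholes process: it is a reverse Γ-adjoint process of itself
    (∀ (σ : ℝ), 0 < σ → ∀ (S₀ : Pos)
      {Ω₁ : Type*} [mΩ₁ : MeasurableSpace Ω₁] (Q₁ : Measure Ω₁) [IsProbabilityMeasure Q₁]
      (W : ℝ≥0 → Ω₁ → ℝ) (hW : ∀ t, Measurable (W t)), IsBrownianReal W Q₁ →
      IsMarkovProcess (bsTransition 𝒯 σ) (bsProcess 𝒯 σ S₀ W)
        (Filtration.natural (bsProcess 𝒯 σ S₀ W) (stronglyMeasurable_bsProcess 𝒯 σ S₀ hW)) Q₁ ∧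
      IsReverseGammaAdjointKernel (bsTransition 𝒯 σ) (bsTransition 𝒯 σ)) := by
  -- For continuous laws with martingale transitions, (A2) implies spot regularity, so parts (a) to
  -- (c) need only the latter.
  have hreg : κ.IsMartingale → (κ.ScalingProperty ∨ κ.SpotRegular) → κ.SpotRegular :=
    fun hM h => h.elim (fun hs => hs.spotRegular hM hκ) id
  have hstart : ∀ t, 𝒯.start ≤ t := fun t => (𝒯.subset_Icc t.2).1
  refine ⟨fun hs hM => hS.isMartingale_transition hs hM, fun hM h => ⟨?_, ?_, ?_⟩,
    fun hM h ν _ => ?_, ?_, fun σ hσ S₀ Ω₁ _ Q₁ _ W hW hB => ⟨?_, ?_⟩⟩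
  · intro t t' ht k
    have hr := hreg hM h
    have hlt := 𝒯.rev_lt_rev ht
    exact ⟨fun k' => (hr.convex _ _ hlt k k.2).deriv_deriv_nonneg
      (hr.differentiable _ _ hlt k k.2) k'.2, hM.lintegral_gammaDensity hr hlt k⟩
  · intro t t' t'' ht ht' k
    exact hM.gammaDensity_chapman_kolmogorov (hreg hM h) (𝒯.rev_lt_rev ht') (𝒯.rev_lt_rev ht) k
  · exact ⟨_, κ.isReverseGammaAdjointKernel_reverseGammaAdjoint hM (hreg hM h)⟩
  · obtain ⟨μ, ℱ, hμ, hX, h0⟩ :=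
      (κ.reverseGammaAdjoint hM (hreg hM h)).exists_markovian_pathLaw hstart ν
    exact ⟨_, 𝒯.times → Pos, inferInstance, μ, ℱ, fun t ω => ω t, hμ,
      κ.isReverseGammaAdjointKernel_reverseGammaAdjoint hM (hreg hM h), hX, h0⟩
  · intro κ' hκ' Ω' _ Q' _ 𝓖' S' hS'
    have hmeas : Measurable (Function.uncurry divPos) :=
      measurable_divPos_prod.comp measurable_swap
    refine ⟨fun hM h => ?_, fun hs => ⟨hs.scalingProperty_reverse hκ hκ', fun t t' ht => ?_⟩,
      fun hs hp t t' ht => ?_⟩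
    · have hM' := hM.isMartingale_reverse (hreg hM h) hκ'
      exact ⟨hM', fun h0 => hS'.martingale hM' hstart h0⟩
    · have hlt := 𝒯.rev_lt_rev ht
      have := κ.markov _ _ hlt.le
      have hac := hκ _ _ hlt onePos
      have hm : Measurable fun ω => divPos (S (𝒯.rev t) ω) (S (𝒯.rev t') ω) :=
        hmeas.comp ((hS.measurable _).prodMk (hS.measurable _))
      have hm' : Measurable fun ω => divPos (S' t' ω) (S' t ω) :=
        hmeas.comp ((hS'.measurable _).prodMk (hS'.measurable _))
      have hlaw := hS.map_ratio hlt.le (hs.hasRatioLaw hlt)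
      have hlaw' := hS'.map_ratio ht.le (hs.hasRatioLaw_reverse hκ hκ' ht)
      have hl : Q.map (fun ω => Real.log ((S (𝒯.rev t) ω : ℝ) / S (𝒯.rev t') ω)) =
          (κ.kernel (𝒯.rev t') (𝒯.rev t) onePos).map fun y : Pos => Real.log (y : ℝ) := by
        rw [← hlaw, Measure.map_map measurable_log_coe hm]
        rfl
      have hl' : Q'.map (fun ω => Real.log ((S' t' ω : ℝ) / S' t ω)) =
          (dualLaw onePos (κ.kernel (𝒯.rev t') (𝒯.rev t) onePos)).map fun y : Pos => Real.log (y : ℝ) := by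
        rw [← hlaw', Measure.map_map measurable_log_coe hm']
        rfl
      refine ⟨hasPDF_log_of_map_eq hm (hlaw ▸ hac),
        hasPDF_log_of_map_eq hm' (hlaw' ▸ absolutelyContinuous_dualLaw hac onePos), ?_⟩
      rw [pdf_def, pdf_def, hl, hl', map_log_dualLaw hac]
      refine Measure.rnDeriv_withDensity _ (Measurable.mul (by fun_prop) ?_)
      exact (Measure.measurable_rnDeriv _ _).comp measurable_neg
    · have hlt := 𝒯.rev_lt_rev ht
      have := κ.markov _ _ hlt.le
      have hm : Measurable fun ω => divPos (S (𝒯.rev t) ω) (S (𝒯.rev t') ω) :=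
        hmeas.comp ((hS.measurable _).prodMk (hS.measurable _))
      have hm' : Measurable fun ω => divPos (S' t' ω) (S' t ω) :=
        hmeas.comp ((hS'.measurable _).prodMk (hS'.measurable _))
      have hr := hs.hasRatioLaw hlt
      have hlaw' := hS'.map_ratio ht.le (hs.hasRatioLaw_reverse hκ hκ' ht)
      rw [hp.dualLaw_eq hlt hr (hs.lintegral_coe_of_reverse hκ hκ' ht),
        ← hS.map_ratio hlt.le hr] at hlaw'
      exact IdentDistrib.comp ⟨hm'.aemeasurable, hm.aemeasurable, hlaw'⟩ measurable_subtype_coe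
  · exact isMarkovProcess_bsProcess 𝒯 σ S₀ hW hB.toIsPreBrownianReal
  · exact isReverseGammaAdjointKernel_bsTransition 𝒯 hσ
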